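/- Theorem 1.1. Let $p\ge 1$, let $V:\mathbb Z\to\mathbb R$ be $p$-periodic, and let $H$ be the Jacobi (discrete Schrödinger) operator on $\ell^2(\mathbb Z)$, $(Hu)(n)=u(n+1)+u(n-1)+V(n)u(n)$. For $E\in\mathbb R$ let $$M_E(p)=\begin{pmatrix}E-V(p)&-1\\1&0\end{pmatrix}\cdots\begin{pmatrix}E-V(1)&-1\\1&0\end{pmatrix}$$ be the $p$-step transfer matrix and $D(E)=\operatorname{Tr}M_E(p)$ the discriminant. For $\theta\in\mathbb R$ and $L\ge 2$ let $H_L$ be the restriction of $H$ to $\{1,\dots,L-1\}$ with boundary conditions $\sin\theta\,u(0)=\cos\theta\,u(1)$ and $u(L)=0$, and let $k_L(E)=\frac1{L-1}\#\{\lambda\in\sigma(H_L):\lambda\le E\}$. Then for all $E\in\mathbb R$ the limit $k^H(E)=\lim_{L\to\infty}k_L(E)$ (the integrated density of states) exists and does not depend on $\theta$. The spectrum of $H$ is the union of $p$ bands $B_j=[a_j,b_j]$, $j=1,\dots,p$, with $$a_1<b_1\le a_2<b_2\le\dots\le a_p<b_p,$$ where the band edges $a_j,b_j$ are exactly the points of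 $\sigma(H)$ at which $D=\pm2$. Let $G_0=(-\infty,a_1)$, $G_p=(b_p,\infty)$, and for $1\le j\le p-1$ let $G_j=(b_j,a_{j+1})$ if $b_j<a_{j+1}$ and $G_j=\{b_j\}=\{a_{j+1}\}$ if $b_j=a_{j+1}$ be the gaps. For each $E\in\sigma(H)$ there is exactly one $\vartheta\in[0,\pi/p]$ with $D(E)=2\cos(p\vartheta)$, and, with this $\vartheta$, $$k^H(E)=\begin{cases}\dfrac jp, & E\in G_j,\ 0\le j\le p,\\[1ex] \dfrac jp-\dfrac\vartheta\pi, & E\in B_j,\ 1\le j\le p,\ p-j\text{ even},\\[1ex] \dfrac{j-1}p+\dfrac\vartheta\pi, & E\in B_j,\ 1\le j\le p,\ p-j\text{ odd}.\end{cases}$$ -/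

import Mathlib

open Set Filter Topology

noncomputable section

namespace PeriodicJacobi

/-- The Hilbert space `ℓ²(ℤ)` of complex square-summable two-sided sequences. -/
abbrev L2Z : Type := lp (fun _ : ℤ => ℂ) 2

/-- Translation `(S_k u)(n) = u (n + k)` on `ℓ²(ℤ)`. -/
def shift (k : ℤ) : L2Z →L[ℂ] L2Z :=
  have hmem : ∀ u : L2Z, Memℓp (fun n : ℤ => u (n + k)) 2 := fun u => by
    refine memℓp_gen ?_
    have h := (lp.memℓp u).summable (by norm_num : 0 < (2 : ENNReal).toReal)
    exact (Equiv.addRight k).summable_iff.mpr h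
  LinearMap.mkContinuous
    { toFun := fun u => ⟨fun n => u (n + k), hmem u⟩
      map_add' := fun _ _ => rfl
      map_smul' := fun _ _ => rfl } 1 (fun u => by
      have h2 : 0 < (2 : ENNReal).toReal := by norm_num
      rw [one_mul, lp.norm_eq_tsum_rpow h2, lp.norm_eq_tsum_rpow h2]
      refine le_of_eq ?_
      congr 1
      exact (Equiv.addRight k).tsum_eq (fun n : ℤ => ‖u n‖ ^ (2 : ENNReal).toReal))

@[simp] theorem shift_apply (k : ℤ) (u : L2Z) (n : ℤ) : shift k u n = u (n + k) := rfl

theorem norm_smul_id_le {V : ℤ → ℝ} {C : ℝ} (hC : ∀ n, |V n| ≤ C) (n : ℤ) :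
    ‖(V n : ℂ) • ContinuousLinearMap.id ℂ ℂ‖ ≤ C := by
  rw [norm_smul, ContinuousLinearMap.norm_id, mul_one, Complex.norm_real]
  exact hC n

/-- Multiplication by a bounded real potential on `ℓ²(ℤ)`. -/
def potential (V : ℤ → ℝ) (hV : ∃ C, ∀ n, |V n| ≤ C) : L2Z →L[ℂ] L2Z :=
  lp.mapCLM 2 (fun n : ℤ => (V n : ℂ) • ContinuousLinearMap.id ℂ ℂ)
    ((abs_nonneg (V 0)).trans (hV.choose_spec 0)) (norm_smul_id_le hV.choose_spec)

@[simp] theorem potential_apply (V : ℤ → ℝ) (hV : ∃ C, ∀ n, |V n| ≤ C) (u : L2Z) (n : ℤ) :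
    potential V hV u n = (V n : ℂ) * u n := rfl

/-- The discrete Schrödinger (Jacobi) operator `H` on `ℓ²(ℤ)` with bounded real potential `V`. -/
def jacobi (V : ℤ → ℝ) (hV : ∃ C, ∀ n, |V n| ≤ C) : L2Z →L[ℂ] L2Z :=
  shift 1 + shift (-1) + potential V hV

theorem jacobi_apply (V : ℤ → ℝ) (hV : ∃ C, ∀ n, |V n| ≤ C) (u : L2Z) (n : ℤ) :
    jacobi V hV u n = u (n + 1) + u (n - 1) + (V n : ℂ) * u n := rfl

/-- A periodic potential is bounded. -/
theorem bounded_of_periodic {p : ℕ} (hp : 0 < p) {V : ℤ → ℝ}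
    (hV : Function.Periodic V (p : ℤ)) : ∃ C, ∀ n, |V n| ≤ C := by
  refine ⟨∑ i ∈ Finset.range p, |V i|, fun n => ?_⟩
  have hp' : (0 : ℤ) < p := by exact_mod_cast hp
  have h1 : V n = V (n % p) := by
    have h := hV.int_mul (n / p) (n % p)
    rw [← h]
    congr 1
    have := Int.emod_add_mul_ediv n p
    simp only [Int.cast_id]
    linarith [mul_comm (n / (p : ℤ)) (p : ℤ)]
  have h0 := Int.emod_nonneg n hp'.ne'
  have h2 := Int.emod_lt_of_pos n hp'
  obtain ⟨m, hm⟩ := Int.eq_ofNat_of_zero_le h0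
  rw [h1, hm]
  exact Finset.single_le_sum (f := fun i : ℕ => |V i|) (fun i _ => abs_nonneg _)
    (Finset.mem_range.mpr (by omega))

/-- The transfer matrix `M_E(n)`: every solution of `u (k+1) + u (k-1) + V k * u k = E * u k`
satisfies `(u (n+1), u n)ᵀ = M_E(n) (u 1, u 0)ᵀ`. -/
def transfer (V : ℤ → ℝ) (E : ℝ) : ℕ → Matrix (Fin 2) (Fin 2) ℝ
  | 0 => 1
  | n + 1 => !![E - V (n + 1), -1; 1, 0] * transfer V E n

/-- The discriminant `D(E) = Tr M_E(p)`. -/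
def discriminant (p : ℕ) (V : ℤ → ℝ) (E : ℝ) : ℝ := (transfer V E p).trace

/-- The spectrum of the restriction `H_L` of `H` to the sites `1, …, L - 1` with boundary
conditions `u 0 / u 1 = cot θ` (i.e. `sin θ * u 0 = cos θ * u 1`) and `u L = 0`: the set of
its eigenvalues. -/
def finiteSpectrum (V : ℤ → ℝ) (θ : ℝ) (L : ℕ) : Set ℝ :=
  {lam | ∃ u : ℤ → ℝ,
    (∃ n : ℤ, 1 ≤ n ∧ n < L ∧ u n ≠ 0) ∧
    Real.sin θ * u 0 = Real.cos θ * u 1 ∧ u L = 0 ∧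
    ∀ n : ℤ, 1 ≤ n → n < L → u (n + 1) + u (n - 1) + V n * u n = lam * u n}

/-- The finite-volume integrated density of states `k_L(E)`. -/
def finiteIDS (V : ℤ → ℝ) (θ : ℝ) (L : ℕ) (E : ℝ) : ℝ :=
  ({lam ∈ finiteSpectrum V θ L | lam ≤ E}.ncard : ℝ) / ((L : ℝ) - 1)

/-- `k` is the integrated density of states of `H`: for every energy, `k E` is the limit of the
finite-volume ones, whatever the boundary condition `θ` is. -/
def IsIDS (V : ℤ → ℝ) (k : ℝ → ℝ) : Prop :=
  ∀ E θ : ℝ, Tendsto (fun L : ℕ => finiteIDS V θ L E) atTop (𝓝 (k E))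

/-- `[a j, b j]`, `j = 1, …, p`, are the `p` bands of `σ(H)`: nondegenerate compact intervals,
ordered and with disjoint interiors, whose union is `σ(H)`. Two consecutive bands may touch, at
a collapsed gap; the edges of the bands (collapsed gaps included) are the points of the bands
where the discriminant is `2` or `-2`. -/
structure IsBands (p : ℕ) (V : ℤ → ℝ) (hV : ∃ C, ∀ n, |V n| ≤ C) (a b : ℕ → ℝ) : Prop where
  lt : ∀ j, 1 ≤ j → j ≤ p → a j < b j
  le : ∀ j, 1 ≤ j → j < p → b j ≤ a (j + 1)
  spectrum_eq : spectrum ℂ (jacobi V hV) =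
    Complex.ofReal '' {E : ℝ | ∃ j, 1 ≤ j ∧ j ≤ p ∧ E ∈ Icc (a j) (b j)}
  edge : ∀ j, 1 ≤ j → j ≤ p → ∀ E ∈ Icc (a j) (b j),
    |discriminant p V E| = 2 ↔ E = a j ∨ E = b j

/-- The `j`-th gap, `0 ≤ j ≤ p`: unbounded for `j = 0` and `j = p`; otherwise open, or
collapsed to the common edge of two touching bands. -/
def gap (p : ℕ) (a b : ℕ → ℝ) (j : ℕ) : Set ℝ :=
  if j = 0 then Iio (a 1)
  else if j = p then Ioi (b p)
  else if b j < a (j + 1) then Ioo (b j) (a (j + 1))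
  else {b j}

end PeriodicJacobi

end

open Set Filter Topology

noncomputable section

/-! Write `s` and `c` for the solutions with data (0, 1) and (1, 0) at the sites 0, 1, and `D = s
(p+1) + c p`. The first half shows that σ(H) is `{|D| ≤ 2}`. Modulo the left ideal generated by `H -
E`, the operator `S_p + S_{-p}` equals the scalar `D(E)`. Its norm is at most 2, so for `|D(E)| > 2`
the ideal is everything and `H - E` is left invertible, hence invertible by self-adjointness.
Conversely, when `D(z)` is real with `|D(z)| ≤ 2`, a Floquet solution has `p`-periodic modulus, and
its truncations rule out a bounded inverse (`mem_spectrum_of_trace`). This works for complex `z`.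
Since σ(H) is real, all `p` roots of `D - t` are then real for `|t| ≤ 2`.

Where `|D| < 2`, variation of constants writes `D'` as a sum of values of a definite quadratic form,
so `D' ≠ 0` (`eval_derivative_trace_ne_zero`). Hence `D` has `p` simple zeros, and around each one a
maximal interval on which `|D| < 2`. The closures of these intervals are the bands. They fill `{|D|
≤ 2}` because every point with `|D| = 2` is a limit of points with `|D| < 2`.

For the counting, eigenvalues of `H_L` are zeros of a solution at site `L`, as a polynomial in the
energy. By interlacing, changing the boundary condition or moving `L` by one site changes the count
by at most 1, so it suffices to treat `s` at `L = p (N + 1)`. There `s L = s p * U_N(D / 2)` with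
the Chebyshev polynomial `U_N`, so up to boundedly many zeros the eigenvalues are the energies where
`D` is one of the `N` values `2 cos (π (k + 1) / (N + 1))`. Each band carries each value exactly
once, and `D` is monotone there with a direction fixed by the parity of `p - j`. Counting equally
spaced angles gives the formula. -/

namespace PeriodicJacobi

/-! ### The three-term recurrence over a commutative ring -/

section Recurrence

open Polynomial

variable {R : Type*} [CommRing R]

/-- The solution of `u (n + 2) + u n = w (n + 1) * u (n + 1)` with `u 0 = x`, `u 1 = y`. -/
def sol (w : ℕ → R) (x y : R) : ℕ → R
  | 0 => x
  | 1 => y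
  | n + 2 => w (n + 1) * sol w x y (n + 1) - sol w x y n

@[simp] theorem sol_zero (w : ℕ → R) (x y : R) : sol w x y 0 = x := rfl

@[simp] theorem sol_one (w : ℕ → R) (x y : R) : sol w x y 1 = y := rfl

theorem sol_add_two (w : ℕ → R) (x y : R) (n : ℕ) :
    sol w x y (n + 2) = w (n + 1) * sol w x y (n + 1) - sol w x y n := rfl

theorem sol_unique {w : ℕ → R} {u : ℕ → R} {N : ℕ}
    (hu : ∀ n, n + 2 ≤ N → u (n + 2) = w (n + 1) * u (n + 1) - u n) :
    ∀ n ≤ N, u n = sol w (u 0) (u 1) n := by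
  intro n
  induction n using Nat.twoStepInduction with
  | zero => intro _; rfl
  | one => intro _; rfl
  | more n h1 h2 =>
    intro h
    rw [hu n h, h1 (by omega), h2 (by omega), sol_add_two]

theorem sol_eq_linear (w : ℕ → R) (x y : R) (n : ℕ) :
    sol w x y n = x * sol w 1 0 n + y * sol w 0 1 n := by
  induction n using Nat.twoStepInduction with
  | zero => simp
  | one => simp
  | more n h1 h2 => simp only [sol_add_two, h1, h2]; ring

theorem map_sol {S : Type*} [CommRing S] (f : R →+* S) (w : ℕ → R) (x y : R) (n : ℕ) :
    f (sol w x y n) = sol (fun k => f (w k)) (f x) (f y) n := by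
  induction n using Nat.twoStepInduction with
  | zero => simp
  | one => simp
  | more n h1 h2 => simp only [sol_add_two, map_sub, map_mul, h1, h2]

theorem sol_add (w : ℕ → R) (x y : R) (n m : ℕ) :
    sol w x y (n + m) =
      sol (fun k => w (k + m)) (sol w x y m) (sol w x y (m + 1)) n := by
  induction n using Nat.twoStepInduction with
  | zero => simp
  | one => simp [add_comm]
  | more n h1 h2 =>
    rw [sol_add_two, ← h1, ← h2, show n + 2 + m = (n + m) + 2 by ring, sol_add_two,
      show n + m + 1 = n + 1 + m by ring]

/-- Every one-step transfer matrix has determinant 1. -/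
theorem sol_wronskian (w : ℕ → R) (n : ℕ) :
    sol w 0 1 (n + 1) * sol w 1 0 n - sol w 0 1 n * sol w 1 0 (n + 1) = 1 := by
  induction n with
  | zero => simp
  | succ n ih => rw [sol_add_two, sol_add_two]; linear_combination ih

/-- The trace of the transfer matrix over the sites `1, …, p`. -/
def trace (w : ℕ → R) (p : ℕ) : R := sol w 0 1 (p + 1) + sol w 1 0 p

theorem map_trace {S : Type*} [CommRing S] (f : R →+* S) (w : ℕ → R) (p : ℕ) :
    f (trace w p) = trace (fun k => f (w k)) p := by
  simp [trace, map_sol]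

theorem sol_one_zero_succ (w : ℕ → R) (n : ℕ) :
    sol w 1 0 (n + 1) = -sol (fun k => w (k + 1)) 0 1 n := by
  rw [sol_add, sol_eq_linear]
  simp [sol_add_two]

/-- Cyclicity of the trace: moving the period by one site conjugates the monodromy matrix. -/
theorem trace_shift {w : ℕ → R} {p : ℕ} (hp : 0 < p) (hw : w (p + 1) = w 1) :
    trace (fun k => w (k + 1)) p = trace w p := by
  obtain ⟨q, rfl⟩ : ∃ q, p = q + 1 := ⟨p - 1, by omega⟩
  have h1 : sol w 0 1 (q + 1 + 1) = sol (fun k => w (k + 1)) 1 (w 1) (q + 1) := by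
    rw [sol_add]; simp [sol_add_two]
  rw [trace, trace, h1, sol_eq_linear _ 1 (w 1), sol_one_zero_succ w q, sol_add_two, hw]
  ring

/-- Cayley–Hamilton for the monodromy matrix `M`: since `det M = 1`, `M² + 1 = (tr M) M`. -/
theorem sol_periodic_add {w : ℕ → R} {p : ℕ} (hw : ∀ k, w (k + p) = w k) (x y : R) (n : ℕ) :
    sol w x y (n + p * 2) + sol w x y n = trace w p * sol w x y (n + p) := by
  have hw' : (fun k => w (k + p)) = w := funext hw
  have key : ∀ m, sol w x y (m + p) = sol w (sol w x y p) (sol w x y (p + 1)) m := fun m => by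
    rw [sol_add, hw']
  have hW := sol_wronskian w p
  have e2 : ∀ m, sol w x y (m + p * 2) =
      sol w (sol w x y (p * 2)) (sol w x y (p * 2 + 1)) m := fun m => by
    rw [show m + p * 2 = m + p + p by ring, key, sol_add, hw', ← key, ← mul_two,
      show p + 1 = 1 + p by ring, show p * 2 + 1 = 1 + p + p by ring, key (1 + p), add_comm 1 p]
  have a0 : sol w x y (p * 2) = trace w p * sol w x y p - x := by
    rw [mul_two, key p, sol_eq_linear w (sol w x y p), sol_eq_linear w x y,
      sol_eq_linear w x y (p + 1), trace]
    linear_combination -x * hW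
  have a1 : sol w x y (p * 2 + 1) = trace w p * sol w x y (p + 1) - y := by
    rw [show p * 2 + 1 = p + 1 + p by ring, key (p + 1), sol_eq_linear w (sol w x y p),
      sol_eq_linear w x y, sol_eq_linear w x y (p + 1), trace]
    linear_combination -y * hW
  rw [e2, a0, a1, key]
  rw [sol_eq_linear, sol_eq_linear w x y n, sol_eq_linear w (sol w x y p)]
  ring

end Recurrence

/-! ### Solutions as polynomials in the energy -/

section Poly

open Polynomial

variable {R : Type*} [CommRing R]

theorem eval_sol (v : ℕ → R) (x y E : R) (n : ℕ) :
    (sol (fun k => X - C (v k)) (C x) (C y) n).eval E = sol (fun k => E - v k) x y n := by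
  have := map_sol (evalRingHom E) (fun k => X - C (v k)) (C x) (C y) n
  simpa using this

theorem monic_sol [Nontrivial R] (v : ℕ → R) (n : ℕ) :
    (sol (fun k => X - C (v k)) 0 1 (n + 1)).Monic ∧
      (sol (fun k => X - C (v k)) 0 1 (n + 1)).degree = (n : WithBot ℕ) ∧
      (sol (fun k => X - C (v k)) 0 1 n).degree < (n : WithBot ℕ) := by
  induction n with
  | zero => simp [degree_one]
  | succ n ih =>
    obtain ⟨h1, h2, h3⟩ := ih
    have hm : ((X - C (v (n + 1))) * sol (fun k => X - C (v k)) 0 1 (n + 1)).Monic :=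
      (monic_X_sub_C _).mul h1
    have hd : ((X - C (v (n + 1))) * sol (fun k => X - C (v k)) 0 1 (n + 1)).degree
        = ((n + 1 : ℕ) : WithBot ℕ) := by
      rw [h1.degree_mul, h2, degree_X_sub_C]; push_cast; ring
    have hlt : (sol (fun k => X - C (v k)) 0 1 n).degree < ((n + 1 : ℕ) : WithBot ℕ) :=
      h3.trans (by exact_mod_cast Nat.lt_succ_self n)
    refine ⟨?_, ?_, ?_⟩
    · rw [sol_add_two]; exact hm.sub_of_left (by rw [hd]; exact hlt)
    · rw [sol_add_two, degree_sub_eq_left_of_degree_lt (by rw [hd]; exact hlt), hd]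
    · rw [h2]; exact_mod_cast Nat.lt_succ_self n

theorem monic_trace [Nontrivial R] (v : ℕ → R) {p : ℕ} (hp : 0 < p) :
    (trace (fun k => X - C (v k)) p).Monic ∧ (trace (fun k => X - C (v k)) p).natDegree = p := by
  obtain ⟨q, rfl⟩ : ∃ q, p = q + 1 := ⟨p - 1, by omega⟩
  obtain ⟨h1, h2, -⟩ := monic_sol v (q + 1)
  have h3 := (monic_sol (fun k => v (k + 1)) q).2.2
  have hlt : (sol (fun k => X - C (v k)) 1 0 (q + 1)).degree < ((q + 1 : ℕ) : WithBot ℕ) := by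
    rw [sol_one_zero_succ, degree_neg]
    exact h3.trans (by exact_mod_cast Nat.lt_succ_self q)
  rw [trace]
  refine ⟨h1.add_of_left (by rw [h2]; exact hlt), natDegree_eq_of_degree_eq_some ?_⟩
  rw [degree_add_eq_left_of_degree_lt (by rw [h2]; exact hlt), h2]

/-- The kernel of the variation of constants formula. -/
def green (w : ℕ → R) (n k : ℕ) : R := sol w 0 1 n * sol w 1 0 k - sol w 1 0 n * sol w 0 1 k

/-- Differentiating the recurrence in the energy gives the same recurrence with the solution itself
as source term; variation of constants solves it. -/
theorem derivative_sol (v : ℕ → R) (x y : R) (n : ℕ) :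
    derivative (sol (fun k => X - C (v k)) (C x) (C y) n) =
      ∑ k ∈ Finset.Ico 1 n, green (fun k => X - C (v k)) n k *
        sol (fun k => X - C (v k)) (C x) (C y) k := by
  set w : ℕ → R[X] := fun k => X - C (v k) with hw
  induction n using Nat.twoStepInduction with
  | zero => simp
  | one => simp
  | more n h1 h2 =>
    have hG : ∀ k, green w (n + 2) k = w (n + 1) * green w (n + 1) k - green w n k := fun k => by
      simp only [green, sol_add_two]; ring
    have h00 : green w (n + 1) (n + 1) = 0 := by simp only [green]; ring
    have h01 : green w (n + 2) (n + 1) = 1 := by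
      rw [← sol_wronskian w (n + 1)]; simp only [green]; ring
    have h0 : green w n n = 0 := by simp only [green]; ring
    have hn : ∑ k ∈ Finset.Ico 1 n, green w n k * sol w (C x) (C y) k =
        ∑ k ∈ Finset.Ico 1 (n + 1), green w n k * sol w (C x) (C y) k := by
      rcases Nat.eq_zero_or_pos n with rfl | hn
      · simp
      · rw [Finset.sum_Ico_succ_top hn, h0]; simp
    have hdw : derivative (w (n + 1)) = 1 := by simp [hw]
    rw [sol_add_two, derivative_sub, derivative_mul, h1, h2, hn,
      Finset.sum_Ico_succ_top (by omega : 1 ≤ n + 1), h01, hdw]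
    simp only [hG, sub_mul, Finset.sum_sub_distrib, mul_assoc, Finset.mul_sum]
    ring

end Poly

/-! ### Nonvanishing derivative of the discriminant, and Wronskians in the energy -/

section RealPoly

open Polynomial

variable (v : ℕ → ℝ)

theorem eval_green (E : ℝ) (n k : ℕ) :
    (green (fun k => X - C (v k)) n k).eval E = green (fun k => E - v k) n k := by
  have h1 := fun m => eval_sol v 0 1 E m
  have h2 := fun m => eval_sol v 1 0 E m
  simp only [map_zero, map_one] at h1 h2
  simp [green, h1, h2]

theorem eval_trace (p : ℕ) (E : ℝ) :
    (trace (fun k => X - C (v k)) p).eval E = trace (fun k => E - v k) p := by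
  have := map_trace (evalRingHom E) (fun k => X - C (v k)) p
  simpa using this

theorem eval_derivative_sol (x y E : ℝ) (n : ℕ) :
    (derivative (sol (fun k => X - C (v k)) (C x) (C y) n)).eval E =
      ∑ k ∈ Finset.Ico 1 n, green (fun k => E - v k) n k * sol (fun k => E - v k) x y k := by
  rw [derivative_sol, eval_finsetSum]
  simp [eval_green, eval_sol]

theorem eval_derivative_trace_ne_zero {p : ℕ} (hp : 0 < p) {E : ℝ}
    (hE : |trace (fun k => E - v k) p| < 2) :
    (derivative (trace (fun k => X - C (v k)) p)).eval E ≠ 0 := by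
  have h1 := eval_derivative_sol v 0 1 E (p + 1)
  have h2 := eval_derivative_sol v 1 0 E p
  simp only [map_zero, map_one] at h1 h2
  have h0 : green (fun k => E - v k) p p = 0 := by simp only [green]; ring
  have h2' : eval E (derivative (sol (fun k => X - C (v k)) 1 0 p)) =
      ∑ k ∈ Finset.Ico 1 (p + 1), green (fun k => E - v k) p k *
        sol (fun k => E - v k) 1 0 k := by
    rw [h2, Finset.sum_Ico_succ_top hp, h0]; simp
  rw [trace, derivative_add, eval_add, h1, h2', ← Finset.sum_add_distrib]
  have hW := sol_wronskian (fun k => E - v k) p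
  set w : ℕ → ℝ := fun k => E - v k
  set s := sol w 0 1
  set c := sol w 1 0
  have hlt : (s (p + 1) + c p) ^ 2 < 4 := by
    have := sq_lt_sq' (by linarith [(abs_lt.mp hE).1]) (abs_lt.mp hE).2
    simp only [trace] at this
    linarith
  -- Each summand of `D'` is one fixed quadratic form evaluated at `(s k, c k)`. Its discriminant is
  -- `(tr M)² - 4 det M`, negative here, so the form is definite; `k = 1`, where `(s, c) = (1, 0)`,
  -- makes the sum strictly nonzero.
  have hq : ∀ k, green w (p + 1) k * s k + green w p k * c k =
      -c (p + 1) * s k ^ 2 + (s (p + 1) - c p) * s k * c k + s p * c k ^ 2 := fun k => by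
    simp only [green]; ring
  have hdisc : (s (p + 1) - c p) ^ 2 + 4 * (s p * c (p + 1)) < 0 := by
    nlinarith
  have hcne : c (p + 1) ≠ 0 := by
    intro h; rw [h] at hdisc; nlinarith [sq_nonneg (s (p + 1) - c p)]
  have hmul : ∀ k, -4 * c (p + 1) * (green w (p + 1) k * s k + green w p k * c k) =
      (2 * c (p + 1) * s k - (s (p + 1) - c p) * c k) ^ 2 +
        (-((s (p + 1) - c p) ^ 2 + 4 * (s p * c (p + 1)))) * c k ^ 2 := fun k => by
    rw [hq]; ring
  intro hsum
  have hpos : 0 < ∑ k ∈ Finset.Ico 1 (p + 1),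
      -4 * c (p + 1) * (green w (p + 1) k * s k + green w p k * c k) := by
    refine Finset.sum_pos' (fun k _ => ?_) ⟨1, by simp; omega, ?_⟩
    · rw [hmul]; nlinarith [sq_nonneg (c k),
        sq_nonneg (2 * c (p + 1) * s k - (s (p + 1) - c p) * c k)]
    · rw [hmul]
      have hs1 : s 1 = 1 := rfl
      have hc1 : c 1 = 0 := rfl
      rw [hs1, hc1]
      have := pow_pos (abs_pos.mpr hcne) 2
      rw [sq_abs] at this
      linarith
  rw [← Finset.mul_sum, hsum] at hpos
  simp at hpos

/-- Christoffel–Darboux identity: each step of the recurrence adds one square. -/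
theorem wronskian_succ (x y E : ℝ) (n : ℕ) :
    (derivative (sol (fun k => X - C (v k)) (C x) (C y) (n + 1))).eval E *
        sol (fun k => E - v k) x y n -
      sol (fun k => E - v k) x y (n + 1) *
        (derivative (sol (fun k => X - C (v k)) (C x) (C y) n)).eval E =
      ∑ k ∈ Finset.Ico 1 (n + 1), sol (fun k => E - v k) x y k ^ 2 := by
  induction n with
  | zero => simp
  | succ n ih =>
    rw [Finset.sum_Ico_succ_top (by omega), ← ih, sol_add_two, sol_add_two]
    simp only [derivative_sub, derivative_mul, derivative_X, derivative_C, eval_add, eval_sub,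
      eval_mul, eval_one, eval_X, eval_C, eval_sol, eval_zero]
    ring

end RealPoly

theorem transfer_eq (V : ℤ → ℝ) (E : ℝ) (n : ℕ) :
    transfer V E n = !![sol (fun k => E - V k) 0 1 (n + 1), sol (fun k => E - V k) 1 0 (n + 1);
      sol (fun k => E - V k) 0 1 n, sol (fun k => E - V k) 1 0 n] := by
  induction n with
  | zero =>
    ext i j; fin_cases i <;> fin_cases j <;> simp [transfer]
  | succ n ih =>
    rw [transfer, ih, sol_add_two, sol_add_two]
    ext i j
    fin_cases i <;> fin_cases j <;> simp [Matrix.mul_apply, Fin.sum_univ_two] <;> ring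

theorem discriminant_eq (p : ℕ) (V : ℤ → ℝ) (E : ℝ) :
    discriminant p V E = trace (fun k => E - V k) p := by
  rw [discriminant, transfer_eq, Matrix.trace_fin_two_of, trace]

/-! ### The spectrum lies in `{|D| ≤ 2}` -/

section Operator

theorem isSelfAdjoint_jacobi (V : ℤ → ℝ) (hV : ∃ C, ∀ n, |V n| ≤ C) :
    IsSelfAdjoint (jacobi V hV) := by
  have hshift : ∀ (k : ℤ) (u v : L2Z), inner ℂ (shift k u) v = inner ℂ u (shift (-k) v) := by
    intro k u v
    rw [lp.inner_eq_tsum, lp.inner_eq_tsum, ← (Equiv.addRight k).tsum_eq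
      (fun n : ℤ => inner ℂ (u n) (shift (-k) v n))]
    simp
  have hpot : ∀ u v : L2Z, inner ℂ (potential V hV u) v = inner ℂ u (potential V hV v) := by
    intro u v
    rw [lp.inner_eq_tsum, lp.inner_eq_tsum]
    congr 1
    ext n
    simp only [potential_apply, RCLike.inner_apply, map_mul, Complex.conj_ofReal]
    ring
  rw [ContinuousLinearMap.isSelfAdjoint_iff_isSymmetric]
  intro u v
  have h1 := hshift 1 u v
  have h2 := hshift (-1) u v
  rw [neg_neg] at h2
  change inner ℂ (shift 1 u + shift (-1) u + potential V hV u) v =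
    inner ℂ u (shift 1 v + shift (-1) v + potential V hV v)
  simp only [inner_add_left, inner_add_right, h1, h2, hpot]
  ring

theorem norm_shift_le (k : ℤ) : ‖shift k‖ ≤ 1 :=
  (shift k).opNorm_le_bound zero_le_one fun u => by
    have h2 : 0 < (2 : ENNReal).toReal := by norm_num
    rw [one_mul, lp.norm_eq_tsum_rpow h2, lp.norm_eq_tsum_rpow h2]
    exact le_of_eq (congrArg (· ^ _) ((Equiv.addRight k).tsum_eq
      (fun n : ℤ => ‖u n‖ ^ (2 : ENNReal).toReal)))

/-- The spectral parameter minus the potential, seen from the site `m`. -/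
def coeff (V : ℤ → ℝ) (E : ℝ) (m : ℤ) (k : ℕ) : ℝ := E - V (m + k)

variable {p : ℕ} {V : ℤ → ℝ}

theorem coeff_add (hV : Function.Periodic V (p : ℤ)) (E : ℝ) (m : ℤ) :
    coeff V E (m + p) = coeff V E m := by
  ext k
  rw [coeff, coeff, ← hV (m + k)]
  congr 2
  ring

theorem trace_coeff (hp : 0 < p) (hV : Function.Periodic V (p : ℤ)) (E : ℝ) (m : ℤ) :
    trace (coeff V E m) p = discriminant p V E := by
  have hstep : ∀ m, trace (coeff V E (m + 1)) p = trace (coeff V E m) p := fun m => by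
    rw [← trace_shift hp (w := coeff V E m)]
    · congr 1
      ext k
      simp only [coeff]
      congr 2
      push_cast
      ring
    · have := congrFun (coeff_add hV E m) 1
      rw [← this]
      simp only [coeff]
      congr 2
      push_cast
      ring
  rw [discriminant_eq]
  induction m using Int.induction_on with
  | zero =>
    congr 1
    ext k
    simp [coeff]
  | succ i ih => rw [hstep, ih]
  | pred i ih => rw [← ih, ← hstep, sub_add_cancel]

theorem sol_coeff_periodic (hV : Function.Periodic V (p : ℤ)) (E x y : ℝ) (n : ℕ) :
    Function.Periodic (fun m : ℤ => sol (coeff V E m) x y n) (p : ℤ) := fun m => by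
  simp only [coeff_add hV]

/-- Multiplication by a solution of the eigenvalue equation, as a function of its base point. -/
def solOp (hp : 0 < p) (hV : Function.Periodic V (p : ℤ)) (E x y : ℝ) (n : ℕ) : L2Z →L[ℂ] L2Z :=
  potential (fun m : ℤ => sol (coeff V E m) x y n)
    (bounded_of_periodic hp (sol_coeff_periodic hV E x y n))

theorem solOp_apply (hp : 0 < p) (hV : Function.Periodic V (p : ℤ)) (E x y : ℝ) (n : ℕ)
    (u : L2Z) (m : ℤ) :
    solOp hp hV E x y n u m = ((sol (coeff V E m) x y n : ℝ) : ℂ) * u m := rfl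

/-- Operator form of propagating a solution from the sites `m`, `m + 1` to `m + n`. The ideal is a
left ideal, so multiplying by potentials and shifts on the left is allowed. -/
theorem shift_sub_mem_span (hp : 0 < p) (hV : Function.Periodic V (p : ℤ)) (E : ℝ) (n : ℕ) :
    shift n - (solOp hp hV E 0 1 n * shift 1 + solOp hp hV E 1 0 n) ∈
      Ideal.span {jacobi V (bounded_of_periodic hp hV) - (E : ℂ) • 1} := by
  set K := jacobi V (bounded_of_periodic hp hV) - (E : ℂ) • 1 with hK
  induction n using Nat.twoStepInduction with
  | zero =>
    convert Submodule.zero_mem _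
    ext u m
    simp [solOp_apply]
  | one =>
    convert Submodule.zero_mem _
    ext u m
    simp [solOp_apply]
  | more n h0 h1 =>
    have hc : Function.Periodic (fun m : ℤ => coeff V E m (n + 1)) (p : ℤ) := fun m => by
      simp only [coeff_add hV]
    have key : shift (n + 2 : ℕ) -
        (solOp hp hV E 0 1 (n + 2) * shift 1 + solOp hp hV E 1 0 (n + 2)) =
        shift (n + 1 : ℕ) * K + potential _ (bounded_of_periodic hp hc) *
          (shift (n + 1 : ℕ) - (solOp hp hV E 0 1 (n + 1) * shift 1 + solOp hp hV E 1 0 (n + 1)))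
        - (shift n - (solOp hp hV E 0 1 n * shift 1 + solOp hp hV E 1 0 n)) := by
      ext u m
      have e1 : m + ((n + 1 : ℕ) : ℤ) + 1 = m + ((n + 2 : ℕ) : ℤ) := by push_cast; ring
      have e2 : m + ((n + 1 : ℕ) : ℤ) - 1 = m + (n : ℤ) := by push_cast; ring
      simp only [hK, _root_.sub_apply, _root_.add_apply,
        mul_apply_eq_comp, _root_.smul_apply,
        one_apply_eq_self, lp.coeFn_sub, lp.coeFn_add, lp.coeFn_smul, Pi.sub_apply,
        Pi.add_apply, Pi.smul_apply, shift_apply, potential_apply, jacobi_apply, solOp_apply,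
        sol_add_two, smul_eq_mul, e1, e2]
      simp only [coeff]
      push_cast
      ring
    rw [key]
    exact Submodule.sub_mem _ (Submodule.add_mem _
      (Ideal.mul_mem_left _ _ (Ideal.subset_span rfl)) (Ideal.mul_mem_left _ _ h1)) h0

/-- Propagation over one period gives `S_p ≡ s_p S_1 + c_p`. Inverting the monodromy matrix, of
determinant 1, gives `S_{-p} ≡ s_{p+1} - s_p S_1`. The `S_1` terms cancel in the sum and the trace
remains. -/
theorem shift_add_shift_neg_sub_mem_span (hp : 0 < p) (hV : Function.Periodic V (p : ℤ)) (E : ℝ) :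
    shift p + shift (-p) - (discriminant p V E : ℂ) • 1 ∈
      Ideal.span {jacobi V (bounded_of_periodic hp hV) - (E : ℂ) • 1} := by
  have h0 := shift_sub_mem_span hp hV E p
  have h1 := shift_sub_mem_span hp hV E (p + 1)
  have key : shift p + shift (-p) - (discriminant p V E : ℂ) • 1 =
      (shift p - (solOp hp hV E 0 1 p * shift 1 + solOp hp hV E 1 0 p)) -
      (solOp hp hV E 0 1 (p + 1) * (shift (-p) *
          (shift p - (solOp hp hV E 0 1 p * shift 1 + solOp hp hV E 1 0 p))) -
        solOp hp hV E 0 1 p * (shift (-p) * (shift (p + 1 : ℕ) -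
          (solOp hp hV E 0 1 (p + 1) * shift 1 + solOp hp hV E 1 0 (p + 1))))) := by
    ext u m
    have e1 : m + (-p : ℤ) + ((p + 1 : ℕ) : ℤ) = m + 1 := by push_cast; ring
    have e2 : m + (-p : ℤ) + (p : ℤ) = m := by ring
    have hc : coeff V E (m + (-p : ℤ)) = coeff V E m := by rw [← coeff_add hV, e2]
    have hW := congrArg (Complex.ofReal) (sol_wronskian (coeff V E m) p)
    rw [← trace_coeff hp hV E m]
    simp only [_root_.sub_apply, _root_.add_apply,
      mul_apply_eq_comp, _root_.smul_apply,
      one_apply_eq_self, lp.coeFn_sub, lp.coeFn_add, lp.coeFn_smul, Pi.sub_apply,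
      Pi.add_apply, Pi.smul_apply, shift_apply, solOp_apply, smul_eq_mul, e1, e2, hc, trace]
    push_cast at hW ⊢
    linear_combination -u (m + (-p : ℤ)) * hW
  rw [key]
  exact Submodule.sub_mem _ h0 (Submodule.sub_mem _
    (Ideal.mul_mem_left _ _ (Ideal.mul_mem_left _ _ h0))
    (Ideal.mul_mem_left _ _ (Ideal.mul_mem_left _ _ h1)))

theorem abs_discriminant_le_of_mem_spectrum (hp : 0 < p) (hV : Function.Periodic V (p : ℤ))
    {E : ℝ} (hE : (E : ℂ) ∈ spectrum ℂ (jacobi V (bounded_of_periodic hp hV))) :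
    |discriminant p V E| ≤ 2 := by
  by_contra! hlt
  have hu : IsUnit (shift p + shift (-p) - (discriminant p V E : ℂ) • 1) := by
    rw [← IsUnit.neg_iff, neg_sub, ← Algebra.algebraMap_eq_smul_one]
    by_contra hn
    have h1 : (discriminant p V E : ℂ) ∈ spectrum ℂ (shift p + shift (-p)) := hn
    have h2 := spectrum.norm_le_norm_mul_of_mem h1
    have h3 : ‖(1 : L2Z →L[ℂ] L2Z)‖ ≤ 1 := ContinuousLinearMap.norm_id_le
    have h4 := norm_add_le (shift p) (shift (-p))
    rw [Complex.norm_real, Real.norm_eq_abs] at h2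
    nlinarith [norm_shift_le p, norm_shift_le (-p), norm_nonneg (shift p + shift (-p)),
      norm_nonneg (1 : L2Z →L[ℂ] L2Z)]
  have htop := Ideal.eq_top_of_isUnit_mem _ (shift_add_shift_neg_sub_mem_span hp hV E) hu
  obtain ⟨B, hB⟩ := Ideal.mem_span_singleton'.mp ((Ideal.eq_top_iff_one _).mp htop)
  set K := jacobi V (bounded_of_periodic hp hV) - (E : ℂ) • 1 with hK
  have hsK : star K = K := by
    rw [hK, star_sub, star_smul, star_one, (isSelfAdjoint_jacobi _ _).star_eq]
    simp
  -- The adjoint of a left inverse of a self-adjoint operator is a right inverse.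
  have hB' : K * star B = 1 := by
    have := congrArg star hB
    rwa [star_mul, star_one, hsK] at this
  have hKu : IsUnit K := ⟨⟨K, B, by rwa [left_inv_eq_right_inv hB hB'], hB⟩, rfl⟩
  apply hE
  change IsUnit (algebraMap ℂ (L2Z →L[ℂ] L2Z) E - _)
  rw [Algebra.algebraMap_eq_smul_one, ← IsUnit.neg_iff, neg_sub]
  exact hKu

/-! ### Bounded solutions, Floquet solutions and the reverse inclusion -/

theorem jacobi_single (V : ℤ → ℝ) (hV : ∃ C, ∀ n, |V n| ≤ C) (n : ℤ) (x : ℂ) :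
    jacobi V hV (lp.single 2 n x) =
      lp.single 2 (n - 1) x + lp.single 2 (n + 1) x + lp.single 2 n ((V n : ℂ) * x) := by
  ext m
  simp only [jacobi_apply, lp.coeFn_add, Pi.add_apply, lp.single_apply, Pi.single_apply]
  rcases eq_or_ne m n with rfl | h
  · have e1 : ¬ m = m - 1 := by omega
    simp [e1]
  · have e1 : (m + 1 = n) = (m = n - 1) := by rw [eq_sub_iff_add_eq]
    have e2 : (m - 1 = n) = (m = n + 1) := by rw [sub_eq_iff_eq_add]
    simp [h, e1, e2]

theorem jacobi_truncation (V : ℤ → ℝ) (hV : ∃ C, ∀ n, |V n| ≤ C) (z : ℂ) {u : ℕ → ℂ}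
    (hu : ∀ n, u (n + 2) = (z - V ((n + 1 : ℕ) : ℤ)) * u (n + 1) - u n) (N : ℕ) :
    (z • 1 - jacobi V hV) (∑ n ∈ Finset.Ico 1 (N + 1), lp.single 2 (n : ℤ) (u n)) =
      lp.single 2 (1 : ℤ) (u 0) - lp.single 2 (0 : ℤ) (u 1) +
        lp.single 2 (N : ℤ) (u (N + 1)) - lp.single 2 ((N : ℤ) + 1) (u N) := by
  induction N with
  | zero => simp
  | succ N ih =>
    have e : ((N + 1 : ℕ) : ℤ) - 1 = N := by push_cast; ring
    have h1 : lp.single 2 ((N + 1 : ℕ) : ℤ) (u (N + 2)) =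
        (lp.single 2 ((N + 1 : ℕ) : ℤ) (z * u (N + 1)) : L2Z) -
        lp.single 2 ((N + 1 : ℕ) : ℤ) ((V ((N + 1 : ℕ) : ℤ) : ℂ) * u (N + 1)) -
          lp.single 2 ((N + 1 : ℕ) : ℤ) (u N) := by
      rw [← lp.single_sub, ← lp.single_sub, hu]
      congr 1
      ring
    rw [Finset.sum_Ico_succ_top (by omega), map_add, ih]
    simp only [_root_.sub_apply, _root_.smul_apply,
      one_apply_eq_self, jacobi_single, e, ← lp.single_smul, smul_eq_mul]
    rw [show N + 1 + 1 = N + 2 by ring, h1]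
    push_cast
    abel

/-- Applied to a truncated solution, `z - H` leaves four boundary terms, bounded by `4 * B`. A
bounded inverse would bound the truncations in `ℓ²`, making the solution square summable and forcing
it to tend to 0. -/
theorem mem_spectrum_of_bounded_solution (V : ℤ → ℝ) (hV : ∃ C, ∀ n, |V n| ≤ C) (z : ℂ)
    {u : ℕ → ℂ} (hu : ∀ n, u (n + 2) = (z - V ((n + 1 : ℕ) : ℤ)) * u (n + 1) - u n)
    {B : ℝ} (hB : ∀ n, ‖u n‖ ≤ B) (hne : ¬ Tendsto u atTop (𝓝 0)) :
    z ∈ spectrum ℂ (jacobi V hV) := by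
  intro hunit
  change IsUnit (algebraMap ℂ (L2Z →L[ℂ] L2Z) z - _) at hunit
  rw [Algebra.algebraMap_eq_smul_one] at hunit
  obtain ⟨K, hK⟩ := hunit
  set v : ℕ → L2Z := fun N => ∑ n ∈ Finset.Ico 1 (N + 1), lp.single 2 (n : ℤ) (u n) with hv
  have hKv : ∀ N, ‖(K : L2Z →L[ℂ] L2Z) (v N)‖ ≤ 4 * B := fun N => by
    rw [hK, hv]
    simp only
    rw [jacobi_truncation V hV z hu N]
    have n1 := norm_sub_le (lp.single 2 (1 : ℤ) (u 0) - lp.single 2 (0 : ℤ) (u 1) +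
      lp.single 2 (N : ℤ) (u (N + 1)) : L2Z) (lp.single 2 ((N : ℤ) + 1) (u N))
    have n2 := norm_add_le (lp.single 2 (1 : ℤ) (u 0) - lp.single 2 (0 : ℤ) (u 1) : L2Z)
      (lp.single 2 (N : ℤ) (u (N + 1)))
    have n3 := norm_sub_le (lp.single 2 (1 : ℤ) (u 0) : L2Z) (lp.single 2 (0 : ℤ) (u 1))
    simp only [lp.norm_single (by norm_num : (0 : ENNReal) < 2)] at n1 n2 n3
    linarith [hB 0, hB 1, hB N, hB (N + 1)]
  have hvb : ∀ N, ‖v N‖ ≤ ‖(↑K⁻¹ : L2Z →L[ℂ] L2Z)‖ * (4 * B) := fun N => by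
    have : v N = (↑K⁻¹ : L2Z →L[ℂ] L2Z) ((K : L2Z →L[ℂ] L2Z) (v N)) := by
      rw [← mul_apply_eq_comp, Units.inv_mul, one_apply_eq_self]
    rw [this]
    exact (ContinuousLinearMap.le_opNorm _ _).trans
      (mul_le_mul_of_nonneg_left (hKv N) (norm_nonneg _))
  have hvn : ∀ N, ‖v N‖ ^ 2 = ∑ n ∈ Finset.Ico 1 (N + 1), ‖u n‖ ^ 2 := fun N => by
    have h := lp.norm_sum_single (E := fun _ : ℤ => ℂ) (p := 2) (by norm_num)
      (fun n : ℤ => u n.toNat) ((Finset.Ico 1 (N + 1)).map Nat.castEmbedding)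
    simp only [Finset.sum_map, Nat.castEmbedding_apply, Int.toNat_natCast, ENNReal.toReal_ofNat,
      Real.rpow_two] at h
    exact h
  have hsum : Summable fun n => ‖u (n + 1)‖ ^ 2 := by
    refine summable_of_sum_range_le (c := (‖(↑K⁻¹ : L2Z →L[ℂ] L2Z)‖ * (4 * B)) ^ 2)
      (fun n => by positivity) fun N => ?_
    have h := pow_le_pow_left₀ (norm_nonneg _) (hvb N) 2
    rw [hvn, Finset.sum_Ico_eq_sum_range] at h
    simpa [add_comm] using h
  apply hne
  rw [← tendsto_add_atTop_iff_nat 1, tendsto_zero_iff_norm_tendsto_zero]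
  have h := hsum.tendsto_atTop_zero.sqrt
  simpa using h

/-- With `t = 2 cos φ`, the monodromy matrix has the unimodular eigenvalue `exp (i φ)`; an
eigenvector supplies the initial data. -/
theorem exists_floquet {w : ℕ → ℂ} {t : ℝ} (hw : ∀ k, w (k + p) = w k)
    (ht : trace w p = t) (ht2 : |t| ≤ 2) :
    ∃ x y ζ : ℂ, ‖ζ‖ = 1 ∧ (x ≠ 0 ∨ y ≠ 0) ∧
      ∀ n, sol w x y (n + p) = ζ * sol w x y n := by
  set φ := Real.arccos (t / 2) with hφ
  have hcos : t = 2 * Real.cos φ := by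
    rw [hφ, Real.cos_arccos (by linarith [(abs_le.mp ht2).1]) (by linarith [(abs_le.mp ht2).2])]
    ring
  set ζ := Complex.exp (φ * Complex.I) with hζ
  have hζn : ‖ζ‖ = 1 := Complex.norm_exp_ofReal_mul_I φ
  have hζ2 : ζ ^ 2 - t * ζ + 1 = 0 := by
    have h1 : (t : ℂ) = ζ + Complex.exp (-(φ * Complex.I)) := by
      rw [hcos]; push_cast
      rw [Complex.two_cos, hζ, neg_mul]
    have h2 : ζ * Complex.exp (-(φ * Complex.I)) = 1 := by
      rw [hζ, ← Complex.exp_add, add_neg_cancel, Complex.exp_zero]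
    rw [h1]; linear_combination -h2
  have hdet : (!![sol w 1 0 p - ζ, sol w 0 1 p;
      sol w 1 0 (p + 1), sol w 0 1 (p + 1) - ζ]).det = 0 := by
    rw [Matrix.det_fin_two_of]
    have hW := sol_wronskian w p
    rw [trace] at ht
    linear_combination hζ2 + hW - ζ * ht
  obtain ⟨v, hv0, hv⟩ := Matrix.exists_mulVec_eq_zero_iff.mpr hdet
  have hv1 := congrFun hv 0
  have hv2 := congrFun hv 1
  simp [Matrix.mulVec, dotProduct, Fin.sum_univ_two] at hv1 hv2
  refine ⟨v 0, v 1, ζ, hζn, ?_, fun n => ?_⟩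
  · by_contra! h
    apply hv0
    ext i
    fin_cases i
    · exact h.1
    · exact h.2
  · have a0 : sol w (v 0) (v 1) p = ζ * v 0 := by
      rw [sol_eq_linear]; linear_combination hv1
    have a1 : sol w (v 0) (v 1) (p + 1) = ζ * v 1 := by
      rw [sol_eq_linear]; linear_combination hv2
    rw [sol_add, funext hw, a0, a1, sol_eq_linear, sol_eq_linear w (v 0)]
    ring

theorem mem_spectrum_of_trace (hp : 0 < p) (hV : Function.Periodic V (p : ℤ)) {z : ℂ} {t : ℝ}
    (ht : trace (fun k => z - V k) p = t) (ht2 : |t| ≤ 2) :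
    z ∈ spectrum ℂ (jacobi V (bounded_of_periodic hp hV)) := by
  have hw : ∀ k : ℕ, z - V ((k + p : ℕ) : ℤ) = z - V k := fun k => by
    push_cast; rw [hV]
  obtain ⟨x, y, ζ, hζ, hxy, hsol⟩ := exists_floquet hw ht ht2
  set u := sol (fun k => z - V k) x y with hu
  have hper : Function.Periodic (fun n => ‖u n‖) p := fun n => by
    simp only [hsol, norm_mul, hζ, one_mul]
  refine mem_spectrum_of_bounded_solution V _ z (u := u) (fun n => sol_add_two _ x y n)
    (B := ∑ i ∈ Finset.range p, ‖u i‖) (fun n => ?_) fun htend => ?_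
  · have : ‖u n‖ = ‖u (n % p)‖ := (hper.map_mod_nat n).symm
    rw [this]
    exact Finset.single_le_sum (f := fun i => ‖u i‖) (fun i _ => norm_nonneg _)
      (Finset.mem_range.mpr (Nat.mod_lt _ hp))
  · have hz : ∀ j, u j = 0 := fun j => by
      have h1 : Tendsto (fun m : ℕ => ‖u (j + m * p)‖) atTop (𝓝 0) := by
        refine (tendsto_zero_iff_norm_tendsto_zero.mp htend).comp ?_
        exact tendsto_atTop_mono (f := id) (fun m => by simp only [id]; nlinarith) tendsto_id
      have h2 : ∀ m : ℕ, ‖u (j + m * p)‖ = ‖u j‖ := fun m => by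
        have := hper.nat_mul m j
        simpa using this
      simp only [h2] at h1
      exact norm_eq_zero.mp (tendsto_nhds_unique tendsto_const_nhds h1)
    rcases hxy with h | h
    · exact h (hz 0)
    · exact h (hz 1)

theorem trace_ofReal (V : ℤ → ℝ) (E : ℝ) :
    trace (fun k : ℕ => (E : ℂ) - V k) p = (discriminant p V E : ℂ) := by
  have := map_trace Complex.ofRealHom (fun k : ℕ => E - V k) p
  simp only [Complex.ofRealHom_eq_coe] at this
  rw [discriminant_eq, this]
  simp

theorem im_eq_zero_of_trace (hp : 0 < p) (hV : Function.Periodic V (p : ℤ)) {z : ℂ} {t : ℝ}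
    (ht : trace (fun k => z - V k) p = t) (ht2 : |t| ≤ 2) : z.im = 0 :=
  (isSelfAdjoint_jacobi V _).im_eq_zero_of_mem_spectrum (mem_spectrum_of_trace hp hV ht ht2)

theorem spectrum_jacobi (hp : 0 < p) (hV : Function.Periodic V (p : ℤ)) :
    spectrum ℂ (jacobi V (bounded_of_periodic hp hV)) =
      Complex.ofReal '' {E : ℝ | |discriminant p V E| ≤ 2} := by
  ext z
  constructor
  · intro hz
    have hre := (isSelfAdjoint_jacobi V _).mem_spectrum_eq_re hz
    rw [hre] at hz
    exact ⟨z.re, abs_discriminant_le_of_mem_spectrum hp hV hz, hre.symm⟩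
  · rintro ⟨E, hE, rfl⟩
    exact mem_spectrum_of_trace hp hV (trace_ofReal V E) hE

end Operator

/-! ### Roots of the discriminant and the band structure -/

section Bands

open Polynomial

variable {p : ℕ} {V : ℤ → ℝ}

/-- The discriminant as a polynomial in the energy. -/
def discPoly (p : ℕ) (V : ℤ → ℝ) : ℝ[X] := trace (fun k : ℕ => X - C (V k)) p

theorem eval_discPoly (p : ℕ) (V : ℤ → ℝ) (E : ℝ) :
    (discPoly p V).eval E = discriminant p V E := by
  rw [discPoly, eval_trace (fun k : ℕ => V k), discriminant_eq]

theorem monic_discPoly (hp : 0 < p) (V : ℤ → ℝ) : (discPoly p V).Monic :=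
  (monic_trace (fun k : ℕ => V k) hp).1

theorem natDegree_discPoly (hp : 0 < p) (V : ℤ → ℝ) : (discPoly p V).natDegree = p :=
  (monic_trace (fun k : ℕ => V k) hp).2

theorem degree_discPoly_pos (hp : 0 < p) (V : ℤ → ℝ) : 0 < (discPoly p V).degree :=
  natDegree_pos_iff_degree_pos.mp (by rwa [natDegree_discPoly hp])

theorem continuous_discriminant (p : ℕ) (V : ℤ → ℝ) : Continuous (discriminant p V) := by
  have : discriminant p V = fun E => (discPoly p V).eval E := funext fun E =>
    (eval_discPoly p V E).symm
  rw [this]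
  exact (discPoly p V).continuous

theorem discriminant_injOn (hp : 0 < p) (V : ℤ → ℝ) {a b : ℝ}
    (h : ∀ x ∈ Ioo a b, |discriminant p V x| < 2) : InjOn (discriminant p V) (Icc a b) := by
  have key : ∀ x ∈ Icc a b, ∀ y ∈ Icc a b, x < y →
      discriminant p V x ≠ discriminant p V y := by
    intro x hx y hy hxy heq
    rw [← eval_discPoly, ← eval_discPoly] at heq
    obtain ⟨c, hc, hc0⟩ := exists_hasDerivAt_eq_zero hxy
      (discPoly p V).continuous.continuousOn heq
      (fun z _ => (discPoly p V).hasDerivAt z)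
    have hlt := h c ⟨hx.1.trans_lt hc.1, hc.2.trans_le hy.2⟩
    rw [discriminant_eq] at hlt
    exact eval_derivative_trace_ne_zero (fun k : ℕ => V k) hp hlt hc0
  intro x hx y hy heq
  rcases lt_trichotomy x y with hlt | rfl | hlt
  · exact absurd heq (key x hx y hy hlt)
  · rfl
  · exact absurd heq.symm (key y hy x hx hlt)

theorem monic_discPoly_sub_C (hp : 0 < p) (V : ℤ → ℝ) (t : ℝ) :
    (discPoly p V - C t).Monic :=
  (monic_discPoly hp V).sub_of_left
    (lt_of_le_of_lt degree_C_le (degree_discPoly_pos hp V))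

/-- A complex root is a spectral point of a self-adjoint operator, hence real. -/
theorem splits_discPoly_sub_C (hp : 0 < p) (hV : Function.Periodic V (p : ℤ)) {t : ℝ}
    (ht : |t| ≤ 2) : (discPoly p V - C t).Splits := by
  refine Splits.of_splits_map Complex.ofRealHom (IsAlgClosed.splits _) fun z hz => ?_
  have h0 : ((discPoly p V - C t).map Complex.ofRealHom).eval z = 0 :=
    (mem_roots'.mp hz).2
  have h1 : trace (fun k : ℕ => z - V k) p = t := by
    have e1 := map_trace (eval₂RingHom Complex.ofRealHom z) (fun k : ℕ => X - C (V k)) p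
    simp only [coe_eval₂RingHom, eval₂_sub, eval₂_X, eval₂_C, Complex.ofRealHom_eq_coe] at e1
    rw [← e1, ← sub_eq_zero]
    rw [eval_map, eval₂_sub, eval₂_C] at h0
    exact h0
  refine ⟨z.re, ?_⟩
  apply Complex.ext
  · simp
  · simp [im_eq_zero_of_trace hp hV h1 ht]

theorem card_roots_discPoly_sub_C (hp : 0 < p) (hV : Function.Periodic V (p : ℤ)) {t : ℝ}
    (ht : |t| ≤ 2) : (discPoly p V - C t).roots.card = p := by
  rw [← (splits_discPoly_sub_C hp hV ht).natDegree_eq_card_roots, natDegree_sub_C,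
    natDegree_discPoly hp]

theorem mem_roots_discPoly_sub_C (hp : 0 < p) (V : ℤ → ℝ) {t x : ℝ} :
    x ∈ (discPoly p V - C t).roots ↔ discriminant p V x = t := by
  rw [mem_roots (monic_discPoly_sub_C hp V t).ne_zero, IsRoot.def, eval_sub, eval_C,
    eval_discPoly, sub_eq_zero]

theorem nodup_roots_discPoly_sub_C (hp : 0 < p) (V : ℤ → ℝ) {t : ℝ} (ht : |t| < 2) :
    (discPoly p V - C t).roots.Nodup := by
  rw [Multiset.nodup_iff_count_le_one]
  intro x
  rw [count_roots]
  by_contra! hlt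
  obtain ⟨h0, h1⟩ :=
    (one_lt_rootMultiplicity_iff_isRoot (monic_discPoly_sub_C hp V t).ne_zero).mp hlt
  have hx : discriminant p V x = t :=
    (mem_roots_discPoly_sub_C hp V).mp (mem_roots'.mpr ⟨(monic_discPoly_sub_C hp V t).ne_zero, h0⟩)
  rw [derivative_sub, derivative_C, sub_zero] at h1
  refine eval_derivative_trace_ne_zero (fun k : ℕ => V k) hp (E := x) ?_ h1
  rw [← discriminant_eq, hx]
  exact ht

theorem pow_card_le_abs_prod {δ y : ℝ} (hδ : 0 ≤ δ) {s : Multiset ℝ}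
    (hs : ∀ r ∈ s, δ ≤ |y - r|) : δ ^ s.card ≤ |(s.map (y - ·)).prod| := by
  induction s using Multiset.induction_on with
  | empty => simp
  | cons r s ih =>
    rw [Multiset.card_cons, pow_succ', Multiset.map_cons, Multiset.prod_cons, abs_mul]
    exact mul_le_mul (hs r (Multiset.mem_cons_self r s))
      (ih fun x hx => hs x (Multiset.mem_cons_of_mem hx)) (pow_nonneg hδ _) (abs_nonneg _)

/-- If `y` stayed at distance `δ` from `{|D| < 2}`, factoring `D - t` into its `p` real roots would
give `|D y - t| ≥ δ ^ p` for all `|t| < 2`, which fails as `t` approaches `D y`. -/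
theorem mem_closure_abs_discriminant_lt (hp : 0 < p) (hV : Function.Periodic V (p : ℤ)) {y : ℝ}
    (hy : |discriminant p V y| ≤ 2) : y ∈ closure {x | |discriminant p V x| < 2} := by
  by_contra hn
  obtain ⟨δ, hδ, hball⟩ : ∃ δ > 0, ∀ x, |discriminant p V x| < 2 → δ ≤ |y - x| := by
    rw [Metric.mem_closure_iff] at hn
    push Not at hn
    obtain ⟨δ, hδ, h⟩ := hn
    exact ⟨δ, hδ, fun x hx => h x hx⟩
  have hlow : ∀ t, |t| < 2 → δ ^ p ≤ |discriminant p V y - t| := fun t ht => by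
    have h1 : discriminant p V y - t = (discPoly p V - C t).eval y := by
      rw [eval_sub, eval_C, eval_discPoly]
    rw [h1, (splits_discPoly_sub_C hp hV ht.le).eval_eq_prod_roots_of_monic
      (monic_discPoly_sub_C hp V t)]
    refine (pow_card_le_abs_prod hδ.le fun r hr => hball r ?_).trans_eq' ?_
    · rwa [(mem_roots_discPoly_sub_C hp V).mp hr]
    · rw [card_roots_discPoly_sub_C hp hV ht.le]
  have hδp : 0 < δ ^ p := pow_pos hδ p
  set d := discriminant p V y
  -- For `t = d * (1 - ε)` and `|d| ≤ 2`, the choice gives `|t| < 2` and `|d - t| ≤ δ ^ p / 2`.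
  set ε := min (δ ^ p / 4) (1 / 2)
  have hε : 0 < ε := lt_min (by positivity) (by norm_num)
  have hε1 : ε ≤ 1 / 2 := min_le_right _ _
  have hε2 : ε ≤ δ ^ p / 4 := min_le_left _ _
  have h1 : |d * (1 - ε)| < 2 := by
    rw [abs_mul, abs_of_nonneg (by linarith : 0 ≤ 1 - ε)]
    nlinarith [abs_nonneg d]
  have h2 := hlow _ h1
  rw [show d - d * (1 - ε) = d * ε by ring, abs_mul, abs_of_pos hε] at h2
  nlinarith

theorem exists_first_eq {f : ℝ → ℝ} (hf : Continuous f) {y c z : ℝ} (hy : f y < c) (hyz : y ≤ z)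
    (hz : c ≤ f z) : ∃ b, y < b ∧ f b = c ∧ ∀ x ∈ Ico y b, f x < c := by
  set S := Ici y ∩ {x | c ≤ f x} with hS
  have hSc : IsClosed S := isClosed_Ici.inter (isClosed_le continuous_const hf)
  have hSb : BddBelow S := ⟨y, fun x hx => hx.1⟩
  have hm : sInf S ∈ S := hSc.csInf_mem ⟨z, hyz, hz⟩ hSb
  have hlt : ∀ x ∈ Ico y (sInf S), f x < c := fun x hx => by
    by_contra! h
    exact absurd (csInf_le hSb ⟨hx.1, h⟩) (not_le.mpr hx.2)
  have hne : y < sInf S := lt_of_le_of_ne hm.1 fun h => by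
    have := hm.2
    rw [mem_ofPred_eq, ← h] at this
    exact absurd hy (not_lt.mpr this)
  refine ⟨sInf S, hne, le_antisymm ?_ hm.2, hlt⟩
  have hcl : sInf S ∈ closure (Ico y (sInf S)) := by
    rw [closure_Ico hne.ne]
    exact right_mem_Icc.mpr hne.le
  exact closure_minimal (fun x hx => (hlt x hx).le) (isClosed_le hf continuous_const) hcl

theorem exists_band_around (hp : 0 < p) (V : ℤ → ℝ) {y : ℝ} (hy : |discriminant p V y| < 2) :
    ∃ a b, a < y ∧ y < b ∧ |discriminant p V a| = 2 ∧ |discriminant p V b| = 2 ∧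
      ∀ x ∈ Ioo a b, |discriminant p V x| < 2 := by
  have hc : Continuous fun x => |discriminant p V x| := (continuous_discriminant p V).abs
  have hc' : Continuous fun x => |discriminant p V (-x)| := hc.comp continuous_neg
  have hT : Tendsto (fun x => |discriminant p V x|) atTop atTop := by
    have := (discPoly p V).tendsto_norm_atTop (degree_discPoly_pos hp V)
      (l := atTop) (z := fun x : ℝ => x) (tendsto_norm_atTop_atTop)
    simpa only [eval_discPoly, Real.norm_eq_abs] using this
  have hT' : Tendsto (fun x => |discriminant p V (-x)|) atTop atTop := by
    have := (discPoly p V).tendsto_norm_atTop (degree_discPoly_pos hp V)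
      (l := atTop) (z := fun x : ℝ => -x) (by simpa only [norm_neg] using tendsto_norm_atTop_atTop)
    simpa only [eval_discPoly, Real.norm_eq_abs] using this
  obtain ⟨z, hz, hyz⟩ := ((hT.eventually_ge_atTop 2).and (eventually_ge_atTop y)).exists
  obtain ⟨z', hz', hyz'⟩ := ((hT'.eventually_ge_atTop 2).and (eventually_ge_atTop (-y))).exists
  obtain ⟨b, hyb, hb, hlt⟩ := exists_first_eq hc hy hyz hz
  obtain ⟨a, hya, ha, hlt'⟩ := exists_first_eq hc' (by simpa using hy) hyz' hz'
  refine ⟨-a, b, by linarith, hyb, ha, hb, fun x hx => ?_⟩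
  rcases le_total y x with h | h
  · exact hlt x ⟨h, hx.2⟩
  · have := hlt' (-x) ⟨by linarith, by linarith [hx.1]⟩
    simpa using this

theorem exists_zero_of_sign_change {x y : ℝ} (hxy : x ≤ y)
    (hx : |discriminant p V x| = 2) (hy : |discriminant p V y| = 2)
    (hne : discriminant p V x ≠ discriminant p V y) :
    ∃ c ∈ Ioo x y, discriminant p V c = 0 := by
  have h0 : (0 : ℝ) ∈ uIcc (discriminant p V x) (discriminant p V y) := by
    rcases eq_or_eq_neg_of_abs_eq hx with h1 | h1 <;>
    rcases eq_or_eq_neg_of_abs_eq hy with h2 | h2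
    · exact absurd (h1.trans h2.symm) hne
    · rw [h1, h2, mem_uIcc]; right; norm_num
    · rw [h1, h2, mem_uIcc]; left; norm_num
    · exact absurd (h1.trans h2.symm) hne
  obtain ⟨c, hc, hc0⟩ := intermediate_value_uIcc (continuous_discriminant p V).continuousOn h0
  rw [uIcc_of_le hxy] at hc
  refine ⟨c, ⟨lt_of_le_of_ne hc.1 fun h => ?_, lt_of_le_of_ne hc.2 fun h => ?_⟩, hc0⟩
  · rw [h, hc0] at hx; norm_num at hx
  · rw [← h, hc0] at hy; norm_num at hy

theorem exists_isBands (hp : 0 < p) (hV : Function.Periodic V (p : ℤ)) :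
    ∃ a b : ℕ → ℝ, IsBands p V (bounded_of_periodic hp hV) a b := by
  have h02 : |(0 : ℝ)| < 2 := by norm_num
  have hcard : (discPoly p V - C 0).roots.toFinset.card = p := by
    rw [Multiset.toFinset_card_of_nodup (nodup_roots_discPoly_sub_C hp V h02),
      card_roots_discPoly_sub_C hp hV h02.le]
  set e := (discPoly p V - C 0).roots.toFinset.orderEmbOfFin hcard with he
  have he0 : ∀ i, discriminant p V (e i) = 0 := fun i => by
    rw [← mem_roots_discPoly_sub_C hp, ← Multiset.mem_toFinset]
    exact Finset.orderEmbOfFin_mem _ hcard i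
  have hsurj : ∀ x, discriminant p V x = 0 → ∃ i, e i = x := fun x hx => by
    rw [← mem_roots_discPoly_sub_C hp, ← Multiset.mem_toFinset] at hx
    have := Finset.range_orderEmbOfFin _ hcard
    rw [← Finset.mem_coe, ← this] at hx
    exact hx
  choose a b hax hxb ha hb hab using fun i : Fin p =>
    exists_band_around hp V (y := e i) (by rw [he0]; exact h02)
  have hinj : ∀ i, InjOn (discriminant p V) (Icc (a i) (b i)) := fun i =>
    discriminant_injOn hp V (hab i)
  set K : Set ℝ := ⋃ i, Icc (a i) (b i) with hK
  have hKc : IsClosed K := isClosed_iUnion_of_finite fun i => isClosed_Icc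
  -- The interval around `y` has end values of opposite sign, so it contains some zero `e i`. An
  -- edge of band `i` separating `y` from `e i` would lie inside that interval, where `|D| < 2`.
  have hltK : {x | |discriminant p V x| < 2} ⊆ K := by
    intro y hy
    obtain ⟨α, β, hα, hβ, hdα, hdβ, hαβ⟩ := exists_band_around hp V hy
    have hne : discriminant p V α ≠ discriminant p V β := fun h =>
      absurd (discriminant_injOn hp V hαβ ⟨le_rfl, (hα.trans hβ).le⟩
        ⟨(hα.trans hβ).le, le_rfl⟩ h) (hα.trans hβ).ne
    obtain ⟨c, ⟨hcα, hcβ⟩, hc0⟩ := exists_zero_of_sign_change (hα.trans hβ).le hdα hdβ hne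
    obtain ⟨i, rfl⟩ := hsurj c hc0
    refine mem_iUnion.mpr ⟨i, ?_, ?_⟩
    · by_contra! h
      have := hαβ (a i) ⟨hα.trans h, (hax i).trans hcβ⟩
      rw [ha] at this
      exact lt_irrefl _ this
    · by_contra! h
      have := hαβ (b i) ⟨hcα.trans (hxb i), h.trans hβ⟩
      rw [hb] at this
      exact lt_irrefl _ this
  have hle : ∀ i, ∀ x ∈ Icc (a i) (b i), |discriminant p V x| ≤ 2 := fun i x hx => by
    rcases eq_or_lt_of_le hx.1 with rfl | h1
    · exact (ha i).le
    rcases eq_or_lt_of_le hx.2 with rfl | h2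
    · exact (hb i).le
    exact (hab i x ⟨h1, h2⟩).le
  have hKeq : K = {x | |discriminant p V x| ≤ 2} := by
    refine Subset.antisymm (iUnion_subset fun i x hx => hle i x hx) fun y hy => ?_
    exact closure_minimal hltK hKc (mem_closure_abs_discriminant_lt hp hV hy)
  -- If `b i` passed `e j`, `D` would vanish twice on band `i`; if it only passed `a j`, a point
  -- with `|D| = 2` would lie inside band `j`.
  have hord : ∀ i j, i < j → b i ≤ a j := fun i j hij => by
    have hlt : e i < e j := e.strictMono hij
    have h1 : b i ≤ e j := by
      by_contra! h
      have := hinj i ⟨(hax i).le, (hxb i).le⟩ ⟨((hax i).trans hlt).le, h.le⟩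
        ((he0 i).trans (he0 j).symm)
      exact hlt.ne this
    by_contra! h
    have := hab j (b i) ⟨h, h1.trans_lt (hxb j)⟩
    rw [hb] at this
    exact lt_irrefl _ this
  -- Reindexing from `Fin p` to `1, …, p`; the value 0 beyond `p` is never used.
  refine ⟨fun n => if h : n - 1 < p then a ⟨n - 1, h⟩ else 0,
    fun n => if h : n - 1 < p then b ⟨n - 1, h⟩ else 0, ⟨?_, ?_, ?_, ?_⟩⟩
  · intro j h1 h2
    have h : j - 1 < p := by omega
    simp only [h, dif_pos]
    exact (hax _).trans (hxb _)
  · intro j h1 h2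
    have h : j - 1 < p := by omega
    have h' : j + 1 - 1 < p := by omega
    simp only [h, h', dif_pos]
    exact hord _ _ (by rw [Fin.lt_def]; simp only; omega)
  · rw [spectrum_jacobi hp hV, ← hKeq]
    congr 1
    ext x
    rw [hK, mem_iUnion]
    constructor
    · rintro ⟨i, hi⟩
      refine ⟨i + 1, by omega, by omega, ?_⟩
      simpa using hi
    · rintro ⟨j, h1, h2, hx⟩
      have h : j - 1 < p := by omega
      simp only [h, dif_pos] at hx
      exact ⟨_, hx⟩
  · intro j h1 h2 x hx
    have h : j - 1 < p := by omega
    simp only [h, dif_pos] at hx ⊢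
    constructor
    · intro hx2
      by_contra! hne
      have := hab _ x ⟨lt_of_le_of_ne hx.1 hne.1.symm, lt_of_le_of_ne hx.2 hne.2⟩
      rw [hx2] at this
      exact lt_irrefl _ this
    · rintro (rfl | rfl)
      · exact ha _
      · exact hb _

namespace IsBands

variable {hb : ∃ C, ∀ n, |V n| ≤ C} {a b : ℕ → ℝ}

/-- Links an arbitrary family of bands, given through σ(H), to the discriminant. -/
theorem abs_le_iff (hp : 0 < p) (hV : Function.Periodic V (p : ℤ))
    (h : IsBands p V (bounded_of_periodic hp hV) a b) (x : ℝ) :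
    |discriminant p V x| ≤ 2 ↔ ∃ j, 1 ≤ j ∧ j ≤ p ∧ x ∈ Icc (a j) (b j) := by
  have h1 := h.spectrum_eq
  rw [spectrum_jacobi hp hV] at h1
  have h2 := Complex.ofReal_injective.image_injective h1
  exact Set.ext_iff.mp h2 x

theorem right_le_left (h : IsBands p V hb a b) {i j : ℕ} (hi : 1 ≤ i) (hij : i < j) (hj : j ≤ p) :
    b i ≤ a j := by
  induction j, hij using Nat.le_induction with
  | base => exact h.le i hi (by omega)
  | succ j hij ih =>
    exact (ih (by omega)).trans ((h.lt j (by omega) (by omega)).le.trans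
      (h.le j (by omega) (by omega)))

theorem right_mono (h : IsBands p V hb a b) {i j : ℕ} (hi : 1 ≤ i) (hij : i ≤ j) (hj : j ≤ p) :
    b i ≤ b j := by
  rcases hij.eq_or_lt with rfl | hlt
  · rfl
  · exact (h.right_le_left hi hlt hj).trans (h.lt j (by omega) hj).le

theorem left_mono (h : IsBands p V hb a b) {i j : ℕ} (hi : 1 ≤ i) (hij : i ≤ j) (hj : j ≤ p) :
    a i ≤ a j := by
  rcases hij.eq_or_lt with rfl | hlt
  · rfl
  · exact (h.lt i hi (by omega)).le.trans (h.right_le_left hi hlt hj)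

theorem abs_left (h : IsBands p V hb a b) {j : ℕ} (h1 : 1 ≤ j) (h2 : j ≤ p) :
    |discriminant p V (a j)| = 2 :=
  (h.edge j h1 h2 _ ⟨le_rfl, (h.lt j h1 h2).le⟩).mpr (Or.inl rfl)

theorem abs_right (h : IsBands p V hb a b) {j : ℕ} (h1 : 1 ≤ j) (h2 : j ≤ p) :
    |discriminant p V (b j)| = 2 :=
  (h.edge j h1 h2 _ ⟨(h.lt j h1 h2).le, le_rfl⟩).mpr (Or.inr rfl)

theorem abs_lt (hp : 0 < p) (hV : Function.Periodic V (p : ℤ))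
    (h : IsBands p V (bounded_of_periodic hp hV) a b) {j : ℕ} (h1 : 1 ≤ j) (h2 : j ≤ p)
    {x : ℝ} (hx : x ∈ Ioo (a j) (b j)) : |discriminant p V x| < 2 := by
  refine lt_of_le_of_ne ((h.abs_le_iff hp hV x).mpr ⟨j, h1, h2, hx.1.le, hx.2.le⟩) fun heq => ?_
  rcases (h.edge j h1 h2 x ⟨hx.1.le, hx.2.le⟩).mp heq with rfl | rfl
  · exact lt_irrefl _ hx.1
  · exact lt_irrefl _ hx.2

theorem mem_Ioo_of_abs_lt (hp : 0 < p) (hV : Function.Periodic V (p : ℤ))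
    (h : IsBands p V (bounded_of_periodic hp hV) a b) {x : ℝ}
    (hx : |discriminant p V x| < 2) : ∃ j, 1 ≤ j ∧ j ≤ p ∧ x ∈ Ioo (a j) (b j) := by
  obtain ⟨j, h1, h2, h3⟩ := (h.abs_le_iff hp hV x).mp hx.le
  refine ⟨j, h1, h2, lt_of_le_of_ne h3.1 fun he => ?_, lt_of_le_of_ne h3.2 fun he => ?_⟩
  · rw [← he, h.abs_left h1 h2] at hx; exact lt_irrefl _ hx
  · rw [he, h.abs_right h1 h2] at hx; exact lt_irrefl _ hx

theorem injOn (hp : 0 < p) (hV : Function.Periodic V (p : ℤ))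
    (h : IsBands p V (bounded_of_periodic hp hV) a b) {j : ℕ} (h1 : 1 ≤ j) (h2 : j ≤ p) :
    InjOn (discriminant p V) (Icc (a j) (b j)) :=
  discriminant_injOn hp V fun _ hx => h.abs_lt hp hV h1 h2 hx

theorem discriminant_left (hp : 0 < p) (hV : Function.Periodic V (p : ℤ))
    (h : IsBands p V (bounded_of_periodic hp hV) a b) {j : ℕ} (h1 : 1 ≤ j) (h2 : j ≤ p) :
    discriminant p V (a j) = -discriminant p V (b j) := by
  have hlt := h.lt j h1 h2
  rcases abs_eq_abs.mp ((h.abs_left h1 h2).trans (h.abs_right h1 h2).symm) with he | he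
  · exact absurd (h.injOn hp hV h1 h2 ⟨le_rfl, hlt.le⟩ ⟨hlt.le, le_rfl⟩ he) hlt.ne
  · exact he

/-- Opposite values would force a zero of `D` inside a gap, whereas zeros are interior to bands. -/
theorem discriminant_left_succ (hp : 0 < p) (hV : Function.Periodic V (p : ℤ))
    (h : IsBands p V (bounded_of_periodic hp hV) a b) {j : ℕ} (h1 : 1 ≤ j) (h2 : j < p) :
    discriminant p V (a (j + 1)) = discriminant p V (b j) := by
  by_contra hne
  obtain ⟨c, hc, hc0⟩ := exists_zero_of_sign_change (h.le j h1 h2) (h.abs_right h1 h2.le)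
    (h.abs_left (by omega) h2) (Ne.symm hne)
  obtain ⟨i, hi1, hi2, hi⟩ := h.mem_Ioo_of_abs_lt hp hV (x := c) (by rw [hc0]; norm_num)
  rcases le_or_gt i j with hij | hij
  · linarith [h.right_mono hi1 hij h2.le, hi.2, hc.1]
  · linarith [h.left_mono (i := j + 1) (by omega) hij hi2, hi.1, hc.2]

/-- `D` is monic, so it tends to `+∞`; the value `-2` would produce a zero to the right of all
bands. -/
theorem discriminant_right_last (hp : 0 < p) (hV : Function.Periodic V (p : ℤ))
    (h : IsBands p V (bounded_of_periodic hp hV) a b) : discriminant p V (b p) = 2 := by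
  rcases eq_or_eq_neg_of_abs_eq (h.abs_right hp le_rfl) with he | he
  · exact he
  exfalso
  have hT : Tendsto (fun x => discriminant p V x) atTop atTop := by
    have := (discPoly p V).tendsto_atTop_of_leadingCoeff_nonneg (degree_discPoly_pos hp V)
      (by rw [(monic_discPoly hp V).leadingCoeff]; exact zero_le_one)
    simpa only [eval_discPoly] using this
  obtain ⟨z, hz, hbz⟩ := ((hT.eventually_ge_atTop 0).and (eventually_ge_atTop (b p))).exists
  obtain ⟨c, hc, hc0⟩ := intermediate_value_Icc hbz (continuous_discriminant p V).continuousOn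
    (show (0 : ℝ) ∈ Icc _ _ from ⟨by rw [he]; norm_num, hz⟩)
  obtain ⟨i, hi1, hi2, hi⟩ := h.mem_Ioo_of_abs_lt hp hV (x := c) (by rw [hc0]; norm_num)
  linarith [h.right_mono hi1 hi2 le_rfl, hi.2, hc.1]

theorem discriminant_right (hp : 0 < p) (hV : Function.Periodic V (p : ℤ))
    (h : IsBands p V (bounded_of_periodic hp hV) a b) {i : ℕ} (hi : i < p) :
    discriminant p V (b (p - i)) = 2 * (-1) ^ i := by
  induction i with
  | zero => simpa using h.discriminant_right_last hp hV
  | succ i ih =>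
    have e : p - i = p - (i + 1) + 1 := by omega
    rw [← h.discriminant_left_succ hp hV (by omega) (by omega), ← e,
      h.discriminant_left hp hV (by omega) (by omega), ih (by omega)]
    ring

theorem strictMonoOn_or_strictAntiOn (hp : 0 < p) (hV : Function.Periodic V (p : ℤ))
    (h : IsBands p V (bounded_of_periodic hp hV) a b) {j : ℕ} (h1 : 1 ≤ j) (h2 : j ≤ p) :
    (Even (p - j) → StrictMonoOn (discriminant p V) (Icc (a j) (b j))) ∧
      (Odd (p - j) → StrictAntiOn (discriminant p V) (Icc (a j) (b j))) := by
  have hlt := h.lt j h1 h2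
  have hr := h.discriminant_right hp hV (i := p - j) (by omega)
  rw [show p - (p - j) = j by omega] at hr
  have hl := h.discriminant_left hp hV h1 h2
  have hcases := (continuous_discriminant p V).continuousOn.strictMonoOn_of_injOn_Icc' hlt.le
    (h.injOn hp hV h1 h2)
  constructor
  · intro he
    refine hcases.resolve_right fun hanti => ?_
    have := hanti ⟨le_rfl, hlt.le⟩ ⟨hlt.le, le_rfl⟩ hlt
    rw [hl, hr, he.neg_one_pow] at this
    norm_num at this
  · intro he
    refine hcases.resolve_left fun hmono => ?_
    have := hmono ⟨le_rfl, hlt.le⟩ ⟨hlt.le, le_rfl⟩ hlt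
    rw [hl, hr, he.neg_one_pow] at this
    norm_num at this

theorem exists_eq (hp : 0 < p) (hV : Function.Periodic V (p : ℤ))
    (h : IsBands p V (bounded_of_periodic hp hV) a b) {j : ℕ} (h1 : 1 ≤ j) (h2 : j ≤ p) {t : ℝ}
    (ht : |t| < 2) : ∃ x ∈ Ioo (a j) (b j), discriminant p V x = t := by
  have hlt := h.lt j h1 h2
  have hl := h.discriminant_left hp hV h1 h2
  obtain ⟨ht1, ht2⟩ := _root_.abs_lt.mp ht
  have h0 : t ∈ uIcc (discriminant p V (a j)) (discriminant p V (b j)) := by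
    rcases eq_or_eq_neg_of_abs_eq (h.abs_right h1 h2) with he | he <;> rw [hl, he, mem_uIcc]
    · left; constructor <;> linarith
    · right; constructor <;> linarith
  obtain ⟨c, hc, hc0⟩ := intermediate_value_uIcc (continuous_discriminant p V).continuousOn h0
  rw [uIcc_of_le hlt.le] at hc
  refine ⟨c, ⟨lt_of_le_of_ne hc.1 fun he => ?_, lt_of_le_of_ne hc.2 fun he => ?_⟩, hc0⟩
  · rw [← hc0, ← he, h.abs_left h1 h2] at ht; exact lt_irrefl _ ht
  · rw [← hc0, he, h.abs_right h1 h2] at ht; exact lt_irrefl _ ht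

end IsBands

end Bands

/-! ### Eigenvalue counting by interlacing -/

section Counting

open Polynomial

/-- The number of distinct zeros of `f` in `(-∞, E]`. -/
def zeroCount (f : ℝ[X]) (E : ℝ) : ℕ := {x | f.eval x = 0 ∧ x ≤ E}.ncard

theorem finite_zeros {f : ℝ[X]} (hf : f ≠ 0) (E : ℝ) : {x | f.eval x = 0 ∧ x ≤ E}.Finite :=
  (finite_setOfPred_isRoot hf).subset fun _ hx => hx.1

/-- Zeros of two polynomials with nonvanishing Wronskian interlace. -/
theorem zeroCount_le_succ {f g : ℝ[X]}
    (h : ∀ x, (derivative f).eval x * g.eval x - f.eval x * (derivative g).eval x ≠ 0) (E : ℝ) :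
    zeroCount f E ≤ zeroCount g E + 1 := by
  have hf : f ≠ 0 := by rintro rfl; simpa using h 0
  have hg : g ≠ 0 := by rintro rfl; simpa using h 0
  rw [zeroCount, zeroCount, ncard_eq_toFinset_card _ (finite_zeros hf E),
    ncard_eq_toFinset_card _ (finite_zeros hg E)]
  refine Finset.card_le_of_interleaved fun x hx y hy hxy _ => ?_
  rw [Finite.mem_toFinset] at hx hy
  by_contra! hn
  have hgne : ∀ z ∈ Icc x y, g.eval z ≠ 0 := by
    intro z hz h0
    rcases eq_or_lt_of_le hz.1 with rfl | h1
    · exact h x (by rw [h0, hx.1]; ring)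
    rcases eq_or_lt_of_le hz.2 with rfl | h2
    · exact h z (by rw [h0, hy.1]; ring)
    · refine absurd (hn z ?_ h1) (not_le.mpr h2)
      rw [Finite.mem_toFinset]
      exact ⟨h0, hz.2.trans hy.2⟩
  -- Rolle for `f / g`: the numerator of its derivative is the Wronskian.
  obtain ⟨c, hc, hc0⟩ := exists_hasDerivAt_eq_zero (f := fun z => f.eval z / g.eval z) hxy
    (f.continuous.continuousOn.div g.continuous.continuousOn hgne)
    (by simp only [hx.1, hy.1, zero_div])
    (fun z hz => (f.hasDerivAt z).div (g.hasDerivAt z) (hgne z ⟨hz.1.le, hz.2.le⟩))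
  have hgc := hgne c ⟨hc.1.le, hc.2.le⟩
  rw [div_eq_zero_iff] at hc0
  exact h c (hc0.resolve_right (pow_ne_zero 2 hgc))

theorem abs_zeroCount_sub_le {f g : ℝ[X]}
    (h : ∀ x, (derivative f).eval x * g.eval x - f.eval x * (derivative g).eval x ≠ 0) (E : ℝ) :
    |(zeroCount f E : ℝ) - zeroCount g E| ≤ 1 := by
  have h1 := zeroCount_le_succ h E
  have h2 := zeroCount_le_succ (f := g) (g := f) (fun x h0 => h x (by linear_combination -h0)) E
  have h1' : (zeroCount f E : ℝ) ≤ zeroCount g E + 1 := by exact_mod_cast h1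
  have h2' : (zeroCount g E : ℝ) ≤ zeroCount f E + 1 := by exact_mod_cast h2
  rw [abs_le]
  constructor <;> linarith

variable (V : ℤ → ℝ)

/-- The characteristic polynomial of `H_L`. -/
def boundaryPoly (x y : ℝ) (L : ℕ) : ℝ[X] := sol (fun k : ℕ => X - C (V k)) (C x) (C y) L

theorem eval_boundaryPoly (x y E : ℝ) (L : ℕ) :
    (boundaryPoly V x y L).eval E = sol (fun k : ℕ => E - V k) x y L :=
  eval_sol (fun k : ℕ => V k) x y E L

/-- When `sin θ = 0` the solution vanishes at site 1, so nontriviality is seen at site 2, which must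
lie below `L`. -/
theorem finiteSpectrum_eq (θ : ℝ) {L : ℕ} (hL : 3 ≤ L) :
    finiteSpectrum V θ L =
      {x | (boundaryPoly V (Real.cos θ) (Real.sin θ) L).eval x = 0} := by
  ext E
  rw [mem_ofPred_eq, eval_boundaryPoly]
  constructor
  · rintro ⟨u, ⟨n, hn1, hnL, hn0⟩, hbc, huL, hrec⟩
    have hu : ∀ n ≤ L, u (n : ℕ) = sol (fun k : ℕ => E - V k) (u 0) (u 1) n := by
      refine sol_unique (u := fun n : ℕ => u n) fun n hn => ?_
      have := hrec (n + 1) (by omega) (by omega)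
      rw [add_sub_cancel_right, show (n : ℤ) + 1 + 1 = n + 2 by ring] at this
      push_cast
      linear_combination this
    have hsc := Real.sin_sq_add_cos_sq θ
    -- The boundary condition makes `(u 0, u 1)` a multiple of `(cos θ, sin θ)`; this is the factor.
    set r := u 0 * Real.cos θ + u 1 * Real.sin θ with hr
    have h0 : u 0 = r * Real.cos θ := by
      rw [hr]; linear_combination (-u 0) * hsc + Real.sin θ * hbc
    have h1 : u 1 = r * Real.sin θ := by
      rw [hr]; linear_combination (-u 1) * hsc - Real.cos θ * hbc
    have hur : ∀ n ≤ L, u (n : ℕ) =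
        r * sol (fun k : ℕ => E - V k) (Real.cos θ) (Real.sin θ) n := fun n hn => by
      rw [hu n hn, h0, h1, sol_eq_linear, sol_eq_linear _ (Real.cos θ)]
      ring
    have hrne : r ≠ 0 := by
      intro hr0
      obtain ⟨m, rfl⟩ := Int.eq_ofNat_of_zero_le (by omega : 0 ≤ n)
      exact hn0 (by rw [hur m (by omega), hr0, zero_mul])
    have := hur L le_rfl
    rw [huL] at this
    exact (mul_eq_zero.mp this.symm).resolve_left hrne
  · intro h0
    set s := sol (fun k : ℕ => E - V k) (Real.cos θ) (Real.sin θ) with hs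
    refine ⟨fun n => s n.toNat, ?_, ?_, ?_, ?_⟩
    · by_cases hsin : Real.sin θ = 0
      · refine ⟨2, by norm_num, by omega, ?_⟩
        have hcos : Real.cos θ ≠ 0 := fun h => by
          have := Real.sin_sq_add_cos_sq θ
          rw [hsin, h] at this
          norm_num at this
        change s 2 ≠ 0
        rw [hs, sol_add_two, zero_add, sol_one, sol_zero, hsin]
        simpa using hcos
      · exact ⟨1, le_rfl, by omega, hsin⟩
    · exact mul_comm _ _
    · exact h0
    · intro n hn1 hnL
      obtain ⟨m, rfl⟩ : ∃ m : ℕ, n = (m : ℤ) + 1 := ⟨(n - 1).toNat, by omega⟩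
      have e1 : ((m : ℤ) + 1 + 1).toNat = m + 2 := by omega
      have e2 : ((m : ℤ) + 1 - 1).toNat = m := by omega
      have e3 : ((m : ℤ) + 1).toNat = m + 1 := by omega
      simp only [e1, e2, e3]
      rw [hs, sol_add_two]
      push_cast
      ring

theorem finiteIDS_eq (θ : ℝ) {L : ℕ} (hL : 3 ≤ L) (E : ℝ) :
    finiteIDS V θ L E =
      zeroCount (boundaryPoly V (Real.cos θ) (Real.sin θ) L) E / ((L : ℝ) - 1) := by
  rw [finiteIDS, zeroCount, finiteSpectrum_eq V θ hL]
  rfl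

/-- By variation of constants the Wronskian in the energy is `x` times a sum of squares of the Green
kernel; for `x = 0` the two polynomials are proportional. -/
theorem abs_zeroCount_boundary_sub_dirichlet_le (x y : ℝ) (hxy : x ≠ 0 ∨ y ≠ 0) {L : ℕ}
    (hL : 2 ≤ L) (E : ℝ) :
    |(zeroCount (boundaryPoly V x y L) E : ℝ) - zeroCount (boundaryPoly V 0 1 L) E| ≤ 1 := by
  by_cases hx : x = 0
  · have hy : y ≠ 0 := hxy.resolve_left (not_not.mpr hx)
    have : zeroCount (boundaryPoly V x y L) E = zeroCount (boundaryPoly V 0 1 L) E := by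
      have hs : ∀ w : ℕ → ℝ, sol w x y L = 0 ↔ sol w 0 1 L = 0 := fun w => by
        rw [sol_eq_linear, hx, zero_mul, zero_add, mul_eq_zero, or_iff_right hy]
      simp only [zeroCount, eval_boundaryPoly, hs]
    rw [this]
    simp
  · refine abs_zeroCount_sub_le (fun z hz => ?_) E
    obtain ⟨m, rfl⟩ : ∃ m, L = m + 1 := ⟨L - 1, by omega⟩
    rw [eval_boundaryPoly, eval_boundaryPoly, boundaryPoly, boundaryPoly,
      eval_derivative_sol (fun k : ℕ => V k), eval_derivative_sol (fun k : ℕ => V k)] at hz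
    set w : ℕ → ℝ := fun k => z - V k with hw
    have hG : ∀ k, green w (m + 1) k * sol w x y k * sol w 0 1 (m + 1) -
        sol w x y (m + 1) * (green w (m + 1) k * sol w 0 1 k) = x * green w (m + 1) k ^ 2 :=
      fun k => by
        rw [sol_eq_linear w x y, sol_eq_linear w x y (m + 1), green]
        ring
    rw [Finset.sum_mul, Finset.mul_sum, ← Finset.sum_sub_distrib] at hz
    simp only [hG] at hz
    rw [← Finset.mul_sum] at hz
    have hlast : green w (m + 1) m = 1 := by
      rw [← sol_wronskian w m, green]; ring
    have hpos : 0 < ∑ k ∈ Finset.Ico 1 (m + 1), green w (m + 1) k ^ 2 :=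
      Finset.sum_pos' (fun k _ => sq_nonneg _)
        ⟨m, Finset.mem_Ico.mpr ⟨by omega, by omega⟩, by rw [hlast]; norm_num⟩
    exact (mul_ne_zero hx hpos.ne') hz

theorem abs_zeroCount_dirichlet_add_sub_le {n : ℕ} (hn : 1 ≤ n) (r : ℕ) (E : ℝ) :
    |(zeroCount (boundaryPoly V 0 1 (n + r)) E : ℝ) - zeroCount (boundaryPoly V 0 1 n) E| ≤ r := by
  induction r with
  | zero => simp
  | succ r ih =>
    have h : |(zeroCount (boundaryPoly V 0 1 (n + r + 1)) E : ℝ) -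
        zeroCount (boundaryPoly V 0 1 (n + r)) E| ≤ 1 := by
      refine abs_zeroCount_sub_le (fun z hz => ?_) E
      have hW := wronskian_succ (fun k : ℕ => V k) 0 1 z (n + r)
      rw [eval_boundaryPoly, eval_boundaryPoly, boundaryPoly, boundaryPoly, hW] at hz
      have hpos : 0 < ∑ k ∈ Finset.Ico 1 (n + r + 1), sol (fun k : ℕ => z - V k) 0 1 k ^ 2 :=
        Finset.sum_pos' (fun k _ => sq_nonneg _)
          ⟨1, Finset.mem_Ico.mpr ⟨le_rfl, by omega⟩, by rw [sol_one]; norm_num⟩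
      exact hpos.ne' hz
    rw [← add_assoc]
    push_cast
    have := abs_sub_le (zeroCount (boundaryPoly V 0 1 (n + r + 1)) E : ℝ)
      (zeroCount (boundaryPoly V 0 1 (n + r)) E) (zeroCount (boundaryPoly V 0 1 n) E)
    linarith

/-! ### Multiples of the period and Chebyshev nodes -/

variable {p : ℕ} {V}

/-- Along multiples of `p`, `sol_periodic_add` is the Chebyshev recursion in `D / 2`. -/
theorem dirichlet_mul_period (hV : Function.Periodic V (p : ℤ)) (E : ℝ) (N : ℕ) :
    sol (fun k : ℕ => E - V k) 0 1 (p * (N + 1)) =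
      sol (fun k : ℕ => E - V k) 0 1 p * (Chebyshev.U ℝ N).eval (discriminant p V E / 2) := by
  have hw : ∀ k : ℕ, E - V ((k + p : ℕ) : ℤ) = E - V k := fun k => by
    push_cast; rw [hV]
  induction N using Nat.twoStepInduction with
  | zero => simp
  | one =>
    have h := sol_periodic_add (w := fun k : ℕ => E - V k) hw 0 1 0
    rw [← discriminant_eq] at h
    simp only [zero_add, sol_zero, add_zero] at h
    rw [show p * (1 + 1) = p * 2 by ring, h]
    simp
    ring
  | more n h1 h2 =>
    have h := sol_periodic_add (w := fun k : ℕ => E - V k) hw 0 1 (p * (n + 1))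
    rw [← discriminant_eq, ← mul_add, show p * (n + 1) + p = p * (n + 1 + 1) by ring, h1, h2] at h
    rw [show p * (n + 2 + 1) = p * (n + 1 + 2) by ring]
    push_cast at h ⊢
    rw [Chebyshev.U_add_two, eval_sub, eval_mul, eval_mul, eval_X, eval_ofNat]
    linear_combination h

/-- The interior Chebyshev node `2 cos (π (k + 1) / (N + 1))`. -/
def node (N k : ℕ) : ℝ := 2 * Real.cos ((k + 1) * Real.pi / (N + 1))

theorem node_angle_mem {N k : ℕ} (hk : k < N) :
    ((k : ℝ) + 1) * Real.pi / (N + 1) ∈ Ioo 0 Real.pi := by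
  have hk' : (k : ℝ) + 1 < N + 1 := by exact_mod_cast Nat.succ_lt_succ hk
  refine ⟨by positivity, ?_⟩
  rw [div_lt_iff₀ (by positivity), mul_comm]
  exact mul_lt_mul_of_pos_left hk' Real.pi_pos

theorem abs_node_lt {N k : ℕ} (hk : k < N) : |node N k| < 2 := by
  have h := node_angle_mem hk
  have h1 := Real.strictAntiOn_cos ⟨le_rfl, Real.pi_pos.le⟩ (Ioo_subset_Icc_self h) h.1
  have h2 := Real.strictAntiOn_cos (Ioo_subset_Icc_self h) ⟨Real.pi_pos.le, le_rfl⟩ h.2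
  rw [Real.cos_zero] at h1
  rw [Real.cos_pi] at h2
  rw [node, abs_lt]
  constructor <;> linarith

theorem node_injOn (N : ℕ) : InjOn (node N) {k | k < N} := fun k hk l hl h => by
  have h1 : Real.cos _ = Real.cos _ := mul_left_cancel₀ two_ne_zero h
  have h2 := Real.injOn_cos (Ioo_subset_Icc_self (node_angle_mem hk))
    (Ioo_subset_Icc_self (node_angle_mem hl)) h1
  have hN : ((N : ℝ) + 1) ≠ 0 := by positivity
  rw [div_left_inj' hN, mul_left_inj' Real.pi_ne_zero] at h2
  exact_mod_cast add_right_cancel h2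

theorem chebyshev_eq_zero_iff (N : ℕ) (d : ℝ) :
    (Chebyshev.U ℝ N).eval (d / 2) = 0 ↔ ∃ k < N, d = node N k := by
  have hne : Chebyshev.U ℝ (N : ℤ) ≠ 0 := by
    intro h
    have := Chebyshev.degree_U_natCast (R := ℝ) N
    rw [h, degree_zero] at this
    exact absurd this.symm (WithBot.coe_ne_bot)
  rw [← IsRoot.def, ← mem_roots hne, Chebyshev.roots_U_real, Finset.mem_val, Finset.mem_image]
  constructor
  · rintro ⟨k, hk, h⟩
    exact ⟨k, Finset.mem_range.mp hk, by rw [node, h]; ring⟩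
  · rintro ⟨k, hk, h⟩
    exact ⟨k, Finset.mem_range.mpr hk, by rw [h, node]; ring⟩

/-- The energies up to `E` at which the discriminant is a Chebyshev node. -/
def nodeSet (p : ℕ) (V : ℤ → ℝ) (N : ℕ) (E : ℝ) : Set ℝ :=
  {x | (∃ k < N, discriminant p V x = node N k) ∧ x ≤ E}

theorem abs_zeroCount_dirichlet_sub_ncard_nodeSet_le (hp : 0 < p)
    (hV : Function.Periodic V (p : ℤ)) (N : ℕ) (E : ℝ) :
    |(zeroCount (boundaryPoly V 0 1 (p * (N + 1))) E : ℝ) - (nodeSet p V N E).ncard| ≤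
      zeroCount (boundaryPoly V 0 1 p) E := by
  have hne : ∀ n, 0 < n → boundaryPoly V 0 1 n ≠ 0 := fun n hn => by
    obtain ⟨q, rfl⟩ : ∃ q, n = q + 1 := ⟨n - 1, by omega⟩
    have := (monic_sol (fun k : ℕ => V k) q).1.ne_zero
    simpa [boundaryPoly] using this
  have hset : {x | (boundaryPoly V 0 1 (p * (N + 1))).eval x = 0 ∧ x ≤ E} =
      {x | (boundaryPoly V 0 1 p).eval x = 0 ∧ x ≤ E} ∪ nodeSet p V N E := by
    ext x
    simp only [mem_ofPred_eq, mem_union, nodeSet, eval_boundaryPoly, dirichlet_mul_period hV,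
      mul_eq_zero, chebyshev_eq_zero_iff]
    tauto
  have hfin := finite_zeros (hne (p * (N + 1)) (by positivity)) E
  have h1 : (nodeSet p V N E).ncard ≤ zeroCount (boundaryPoly V 0 1 (p * (N + 1))) E :=
    ncard_le_ncard (by rw [hset]; exact subset_union_right) hfin
  have h2 : zeroCount (boundaryPoly V 0 1 (p * (N + 1))) E ≤
      zeroCount (boundaryPoly V 0 1 p) E + (nodeSet p V N E).ncard := by
    rw [zeroCount, hset]
    exact ncard_union_le _ _
  have h1' : ((nodeSet p V N E).ncard : ℝ) ≤ zeroCount (boundaryPoly V 0 1 (p * (N + 1))) E := by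
    exact_mod_cast h1
  have h2' : (zeroCount (boundaryPoly V 0 1 (p * (N + 1))) E : ℝ) ≤
      zeroCount (boundaryPoly V 0 1 p) E + (nodeSet p V N E).ncard := by
    exact_mod_cast h2
  rw [abs_le]
  constructor <;> linarith [(Nat.cast_nonneg (zeroCount (boundaryPoly V 0 1 p) E) : (0 : ℝ) ≤ _)]

/-- The count is `min N ⌊α (N + 1)⌋`. -/
theorem abs_card_succ_le_sub_le {α : ℝ} (h0 : 0 ≤ α) (h1 : α ≤ 1) (N : ℕ) :
    |(((Finset.range N).filter fun k : ℕ => (k : ℝ) + 1 ≤ α * (N + 1)).card : ℝ) - N * α| ≤ 1 := by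
  have hβ : 0 ≤ α * ((N : ℝ) + 1) := by positivity
  have hset : ((Finset.range N).filter fun k : ℕ => (k : ℝ) + 1 ≤ α * (N + 1)) =
      Finset.range (min N ⌊α * ((N : ℝ) + 1)⌋₊) := by
    ext k
    rw [Finset.mem_filter, Finset.mem_range, Finset.mem_range, lt_min_iff, ← Nat.succ_le_iff
      (m := k) (n := ⌊_⌋₊), Nat.le_floor_iff hβ]
    push_cast
    rfl
  rw [hset, Finset.card_range]
  have hf1 := Nat.floor_le hβ
  have hf2 := Nat.lt_floor_add_one (α * ((N : ℝ) + 1))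
  have hN : (0 : ℝ) ≤ N := Nat.cast_nonneg N
  push_cast
  rw [abs_le]
  rcases le_total (N : ℝ) (⌊α * ((N : ℝ) + 1)⌋₊ : ℝ) with h | h
  · rw [min_eq_left h]
    constructor <;> nlinarith
  · rw [min_eq_right h]
    constructor <;> nlinarith

/-- The reflection `k ↦ N - 1 - k` turns `k + 1` into `(N + 1) - (k + 1)`. -/
theorem card_le_succ_eq {α : ℝ} (N : ℕ) :
    ((Finset.range N).filter fun k : ℕ => α * (N + 1) ≤ (k : ℝ) + 1).card =
      ((Finset.range N).filter fun k : ℕ => (k : ℝ) + 1 ≤ (1 - α) * (N + 1)).card := by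
  have hcast : ∀ k < N, ((N - 1 - k : ℕ) : ℝ) = N - 1 - k := fun k hk => by
    rw [Nat.cast_sub (by omega), Nat.cast_sub (by omega), Nat.cast_one]
  refine Finset.card_bij' (fun k _ => N - 1 - k) (fun k _ => N - 1 - k) ?_ ?_ ?_ ?_
  · intro k hk
    rw [Finset.mem_filter, Finset.mem_range] at hk ⊢
    refine ⟨by omega, ?_⟩
    rw [hcast k hk.1]
    linarith [hk.2]
  · intro k hk
    rw [Finset.mem_filter, Finset.mem_range] at hk ⊢
    refine ⟨by omega, ?_⟩
    rw [hcast k hk.1]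
    linarith [hk.2]
  · intro k hk
    rw [Finset.mem_filter, Finset.mem_range] at hk
    omega
  · intro k hk
    rw [Finset.mem_filter, Finset.mem_range] at hk
    omega

theorem cos_le_node_iff {α : ℝ} (h0 : 0 ≤ α) (h1 : α ≤ 1) {N k : ℕ} (hk : k < N) :
    (2 * Real.cos (α * Real.pi) ≤ node N k ↔ (k : ℝ) + 1 ≤ α * (N + 1)) ∧
      (node N k ≤ 2 * Real.cos (α * Real.pi) ↔ α * (N + 1) ≤ (k : ℝ) + 1) := by
  have hα : α * Real.pi ∈ Icc 0 Real.pi :=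
    ⟨by positivity, mul_le_of_le_one_left Real.pi_pos.le h1⟩
  have hm := Ioo_subset_Icc_self (node_angle_mem hk)
  have hN : (0 : ℝ) < (N : ℝ) + 1 := by positivity
  rw [node, mul_le_mul_iff_right₀ two_pos, mul_le_mul_iff_right₀ two_pos,
    Real.strictAntiOn_cos.le_iff_ge hα hm, Real.strictAntiOn_cos.le_iff_ge hm hα,
    div_le_iff₀ hN, le_div_iff₀ hN, mul_right_comm α, mul_le_mul_iff_left₀ Real.pi_pos,
    mul_le_mul_iff_left₀ Real.pi_pos]
  exact ⟨Iff.rfl, Iff.rfl⟩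

/-! ### Density of nodes in each band and the limit -/

namespace IsBands

variable {a b : ℕ → ℝ}

/-- The point of the `j`-th band at which the discriminant takes the value `t`. -/
def root (hp : 0 < p) (hV : Function.Periodic V (p : ℤ))
    (h : IsBands p V (bounded_of_periodic hp hV) a b) (j : ℕ) (t : ℝ) : ℝ :=
  if ht : (1 ≤ j ∧ j ≤ p) ∧ |t| < 2 then (h.exists_eq hp hV ht.1.1 ht.1.2 ht.2).choose else 0

theorem root_spec (hp : 0 < p) (hV : Function.Periodic V (p : ℤ))
    (h : IsBands p V (bounded_of_periodic hp hV) a b) {j : ℕ} (h1 : 1 ≤ j) (h2 : j ≤ p) {t : ℝ}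
    (ht : |t| < 2) :
    h.root hp hV j t ∈ Ioo (a j) (b j) ∧ discriminant p V (h.root hp hV j t) = t := by
  rw [root, dif_pos ⟨⟨h1, h2⟩, ht⟩]
  exact (h.exists_eq hp hV h1 h2 ht).choose_spec

theorem eq_of_mem_Ioo (hp : 0 < p) (hV : Function.Periodic V (p : ℤ))
    (h : IsBands p V (bounded_of_periodic hp hV) a b) {i j : ℕ} (hi : 1 ≤ i) (hip : i ≤ p)
    (hj : 1 ≤ j) (hjp : j ≤ p) {x : ℝ} (hxi : x ∈ Ioo (a i) (b i)) (hxj : x ∈ Ioo (a j) (b j)) :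
    i = j := by
  rcases lt_trichotomy i j with hlt | rfl | hlt
  · linarith [h.right_le_left hi hlt hjp, hxi.2, hxj.1]
  · rfl
  · linarith [h.right_le_left hj hlt hip, hxj.2, hxi.1]

/-- The nodes whose point in the `j`-th band is at most `E`. -/
def bandNodes (hp : 0 < p) (hV : Function.Periodic V (p : ℤ))
    (h : IsBands p V (bounded_of_periodic hp hV) a b) (N : ℕ) (E : ℝ) (j : ℕ) : Finset ℕ :=
  (Finset.range N).filter fun k => h.root hp hV j (node N k) ≤ E

/-- Points of the set correspond to pairs (band, node): nodes satisfy `|t| < 2`, so their preimages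
are interior to bands, and band interiors are disjoint. -/
theorem ncard_nodeSet (hp : 0 < p) (hV : Function.Periodic V (p : ℤ))
    (h : IsBands p V (bounded_of_periodic hp hV) a b) (N : ℕ) (E : ℝ) :
    (nodeSet p V N E).ncard = ∑ j ∈ Finset.Icc 1 p, (h.bandNodes hp hV N E j).card := by
  rw [← Finset.card_sigma]
  have hmem : ∀ q ∈ (Finset.Icc 1 p).sigma (h.bandNodes hp hV N E),
      (1 ≤ q.1 ∧ q.1 ≤ p) ∧ q.2 < N ∧ h.root hp hV q.1 (node N q.2) ≤ E := fun q hq => by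
    simpa [bandNodes] using hq
  rw [← Finset.card_image_of_injOn (f := fun q : (_ : ℕ) × ℕ => h.root hp hV q.1 (node N q.2)),
    ← ncard_coe_finset]
  · congr 1
    ext x
    rw [Finset.mem_coe, Finset.mem_image]
    constructor
    · rintro ⟨⟨k, hk, hx⟩, hxE⟩
      obtain ⟨j, h1, h2, hj⟩ := h.mem_Ioo_of_abs_lt hp hV (x := x)
        (by rw [hx]; exact abs_node_lt hk)
      obtain ⟨hr1, hr2⟩ := h.root_spec hp hV h1 h2 (abs_node_lt hk)
      have hrx : h.root hp hV j (node N k) = x :=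
        h.injOn hp hV h1 h2 (Ioo_subset_Icc_self hr1) (Ioo_subset_Icc_self hj) (hr2.trans hx.symm)
      refine ⟨⟨j, k⟩, ?_, hrx⟩
      simp [bandNodes, h1, h2, hk, hrx, hxE]
    · rintro ⟨q, hq, rfl⟩
      obtain ⟨⟨h1, h2⟩, hk, hE⟩ := hmem q hq
      exact ⟨⟨q.2, hk, (h.root_spec hp hV h1 h2 (abs_node_lt hk)).2⟩, hE⟩
  · rintro ⟨i, k⟩ hq ⟨j, l⟩ hq' heq
    obtain ⟨⟨h1, h2⟩, hk, -⟩ := hmem _ hq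
    obtain ⟨⟨h1', h2'⟩, hl, -⟩ := hmem _ hq'
    simp only at h1 h2 hk h1' h2' hl heq
    obtain ⟨hr1, hr2⟩ := h.root_spec hp hV h1 h2 (abs_node_lt hk)
    obtain ⟨hr1', hr2'⟩ := h.root_spec hp hV h1' h2' (abs_node_lt hl)
    rw [← heq] at hr1' hr2'
    have hkl : k = l := node_injOn N hk hl (hr2.symm.trans hr2')
    have hij : i = j := h.eq_of_mem_Ioo hp hV h1 h2 h1' h2' hr1 hr1'
    rw [hkl, hij]

/-- `κ` is the fraction of the `j`-th band below `E`, as counted by Chebyshev nodes. -/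
def HasDensity (hp : 0 < p) (hV : Function.Periodic V (p : ℤ))
    (h : IsBands p V (bounded_of_periodic hp hV) a b) (E : ℝ) (j : ℕ) (κ : ℝ) : Prop :=
  ∀ N : ℕ, |((h.bandNodes hp hV N E j).card : ℝ) - N * κ| ≤ 1

theorem hasDensity_one (hp : 0 < p) (hV : Function.Periodic V (p : ℤ))
    (h : IsBands p V (bounded_of_periodic hp hV) a b) {E : ℝ} {j : ℕ} (h1 : 1 ≤ j) (h2 : j ≤ p)
    (hE : b j ≤ E) : h.HasDensity hp hV E j 1 := fun N => by
  have : h.bandNodes hp hV N E j = Finset.range N := Finset.filter_true_of_mem fun k hk =>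
    (h.root_spec hp hV h1 h2 (abs_node_lt (Finset.mem_range.mp hk))).1.2.le.trans hE
  simp [this]

theorem hasDensity_zero (hp : 0 < p) (hV : Function.Periodic V (p : ℤ))
    (h : IsBands p V (bounded_of_periodic hp hV) a b) {E : ℝ} {j : ℕ} (h1 : 1 ≤ j) (h2 : j ≤ p)
    (hE : E ≤ a j) : h.HasDensity hp hV E j 0 := fun N => by
  have : h.bandNodes hp hV N E j = ∅ := Finset.filter_false_of_mem fun k hk =>
    not_le.mpr (hE.trans_lt
      (h.root_spec hp hV h1 h2 (abs_node_lt (Finset.mem_range.mp hk))).1.1)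
  simp [this]

/-- `D` increases on such a band while the cosine decreases, so energies below `E` match angles
above `α π`, a fraction `1 - α` of them. -/
theorem hasDensity_of_even (hp : 0 < p) (hV : Function.Periodic V (p : ℤ))
    (h : IsBands p V (bounded_of_periodic hp hV) a b) {E : ℝ} {j : ℕ} (h1 : 1 ≤ j) (h2 : j ≤ p)
    (hE : E ∈ Icc (a j) (b j)) (he : Even (p - j)) {α : ℝ} (hα : α ∈ Icc 0 1)
    (hD : discriminant p V E = 2 * Real.cos (α * Real.pi)) :
    h.HasDensity hp hV E j (1 - α) := fun N => by
  have hset : h.bandNodes hp hV N E j =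
      (Finset.range N).filter fun k : ℕ => α * (N + 1) ≤ (k : ℝ) + 1 :=
    Finset.filter_congr fun k hk => by
      have hk' := Finset.mem_range.mp hk
      obtain ⟨hr1, hr2⟩ := h.root_spec hp hV h1 h2 (abs_node_lt hk')
      rw [← ((h.strictMonoOn_or_strictAntiOn hp hV h1 h2).1 he).le_iff_le
        (Ioo_subset_Icc_self hr1) hE, hr2, hD]
      exact (cos_le_node_iff hα.1 hα.2 hk').2
  rw [hset, card_le_succ_eq]
  exact abs_card_succ_le_sub_le (by linarith [hα.2]) (by linarith [hα.1]) N

theorem hasDensity_of_odd (hp : 0 < p) (hV : Function.Periodic V (p : ℤ))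
    (h : IsBands p V (bounded_of_periodic hp hV) a b) {E : ℝ} {j : ℕ} (h1 : 1 ≤ j) (h2 : j ≤ p)
    (hE : E ∈ Icc (a j) (b j)) (ho : Odd (p - j)) {α : ℝ} (hα : α ∈ Icc 0 1)
    (hD : discriminant p V E = 2 * Real.cos (α * Real.pi)) :
    h.HasDensity hp hV E j α := fun N => by
  have hset : h.bandNodes hp hV N E j =
      (Finset.range N).filter fun k : ℕ => (k : ℝ) + 1 ≤ α * (N + 1) :=
    Finset.filter_congr fun k hk => by
      have hk' := Finset.mem_range.mp hk
      obtain ⟨hr1, hr2⟩ := h.root_spec hp hV h1 h2 (abs_node_lt hk')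
      rw [← ((h.strictMonoOn_or_strictAntiOn hp hV h1 h2).2 ho).le_iff_ge hE
        (Ioo_subset_Icc_self hr1), hr2, hD]
      exact (cos_le_node_iff hα.1 hα.2 hk').1
  rw [hset]
  exact abs_card_succ_le_sub_le hα.1 hα.2 N

theorem exists_angle (hp : 0 < p) (hV : Function.Periodic V (p : ℤ))
    (h : IsBands p V (bounded_of_periodic hp hV) a b) {E : ℝ} {j : ℕ} (h1 : 1 ≤ j) (h2 : j ≤ p)
    (hE : E ∈ Icc (a j) (b j)) :
    ∃ α ∈ Icc (0 : ℝ) 1, discriminant p V E = 2 * Real.cos (α * Real.pi) := by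
  have hle := abs_le.mp ((h.abs_le_iff hp hV E).mpr ⟨j, h1, h2, hE⟩)
  refine ⟨Real.arccos (discriminant p V E / 2) / Real.pi,
    ⟨div_nonneg (Real.arccos_nonneg _) Real.pi_pos.le,
      div_le_one_of_le₀ (Real.arccos_le_pi _) Real.pi_pos.le⟩, ?_⟩
  rw [div_mul_cancel₀ _ Real.pi_ne_zero, Real.cos_arccos (by linarith) (by linarith)]
  ring

theorem exists_hasDensity (hp : 0 < p) (hV : Function.Periodic V (p : ℤ))
    (h : IsBands p V (bounded_of_periodic hp hV) a b) (E : ℝ) {j : ℕ} (h1 : 1 ≤ j) (h2 : j ≤ p) :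
    ∃ κ, h.HasDensity hp hV E j κ := by
  rcases le_total E (a j) with hle | hge
  · exact ⟨0, h.hasDensity_zero hp hV h1 h2 hle⟩
  rcases le_total (b j) E with hle' | hge'
  · exact ⟨1, h.hasDensity_one hp hV h1 h2 hle'⟩
  obtain ⟨α, hα, hD⟩ := h.exists_angle hp hV h1 h2 ⟨hge, hge'⟩
  rcases Nat.even_or_odd (p - j) with he | ho
  · exact ⟨_, h.hasDensity_of_even hp hV h1 h2 ⟨hge, hge'⟩ he hα hD⟩
  · exact ⟨_, h.hasDensity_of_odd hp hV h1 h2 ⟨hge, hge'⟩ ho hα hD⟩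

theorem tendsto_finiteIDS (hp : 0 < p) (hV : Function.Periodic V (p : ℤ))
    (h : IsBands p V (bounded_of_periodic hp hV) a b) {E : ℝ} {κ : ℕ → ℝ}
    (hκ : ∀ j, 1 ≤ j → j ≤ p → h.HasDensity hp hV E j (κ j)) (θ : ℝ) :
    Tendsto (fun L : ℕ => finiteIDS V θ L E) atTop (𝓝 ((∑ j ∈ Finset.Icc 1 p, κ j) / p)) := by
  set S := ∑ j ∈ Finset.Icc 1 p, κ j with hS
  have hpR : (0 : ℝ) < p := by exact_mod_cast hp
  set C₀ : ℝ := (zeroCount (boundaryPoly V 0 1 p) E : ℝ) with hC₀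
  -- Error budget: boundary condition (1), `L % p` extra sites (`p`), zeros of `s p` (`C₀`),
  -- rounding of one per band (`p`), and replacing `N` by `(L - 1) / p` (`2 * |S|`).
  set C : ℝ := 1 + p + C₀ + p + 2 * |S| with hC
  have hnode : ∀ N : ℕ, |((nodeSet p V N E).ncard : ℝ) - N * S| ≤ p := fun N => by
    rw [h.ncard_nodeSet hp hV, hS, Finset.mul_sum]
    push_cast
    rw [← Finset.sum_sub_distrib]
    refine (Finset.abs_sum_le_sum_abs _ _).trans ?_
    refine (Finset.sum_le_sum (g := fun _ => (1 : ℝ)) fun j hj => ?_).trans (by simp)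
    rw [Finset.mem_Icc] at hj
    exact hκ j hj.1 hj.2 N
  have hsc : Real.cos θ ≠ 0 ∨ Real.sin θ ≠ 0 := by
    by_contra! hn
    have := Real.sin_sq_add_cos_sq θ
    rw [hn.1, hn.2] at this
    norm_num at this
  have hbound : ∀ L : ℕ, p + 3 ≤ L →
      |finiteIDS V θ L E - S / p| ≤ C / ((L : ℝ) - 1) := fun L hL => by
    have hL1 : (0 : ℝ) < (L : ℝ) - 1 := by
      have : (3 : ℝ) ≤ L := by exact_mod_cast (by omega : 3 ≤ L)
      linarith
    obtain ⟨N, hN⟩ : ∃ N, L / p = N + 1 :=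
      ⟨L / p - 1, by have := Nat.div_pos (by omega : p ≤ L) hp; omega⟩
    have hdiv : p * (N + 1) + L % p = L := by rw [← hN]; exact Nat.div_add_mod L p
    have hr : L % p < p := Nat.mod_lt _ hp
    have b1 := abs_zeroCount_boundary_sub_dirichlet_le V (Real.cos θ) (Real.sin θ) hsc
      (by omega : 2 ≤ L) E
    have b2 := abs_zeroCount_dirichlet_add_sub_le V (n := p * (N + 1))
      (Nat.mul_pos hp (by omega)) (L % p) E
    rw [hdiv] at b2
    have b3 := abs_zeroCount_dirichlet_sub_ncard_nodeSet_le hp hV N E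
    have b4 := hnode N
    have hrR : ((L % p : ℕ) : ℝ) ≤ p := by exact_mod_cast hr.le
    have hr0 : (0 : ℝ) ≤ ((L % p : ℕ) : ℝ) := Nat.cast_nonneg _
    have hp1 : (1 : ℝ) ≤ p := by exact_mod_cast hp
    have hdivR : (p : ℝ) * (N + 1) + ((L % p : ℕ) : ℝ) = L := by exact_mod_cast hdiv
    have b5 : |(N : ℝ) * S - ((L : ℝ) - 1) * (S / p)| ≤ 2 * |S| := by
      have e : (N : ℝ) * S - ((L : ℝ) - 1) * (S / p) =
          -((p - 1 + ((L % p : ℕ) : ℝ)) / p) * S := by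
        rw [← hdivR]; field_simp; ring
      rw [e, abs_mul, abs_neg]
      refine mul_le_mul_of_nonneg_right ?_ (abs_nonneg S)
      rw [abs_of_nonneg (div_nonneg (by linarith) hpR.le), div_le_iff₀ hpR]
      linarith
    rw [finiteIDS_eq V θ (by omega : 3 ≤ L)]
    have e : (zeroCount (boundaryPoly V (Real.cos θ) (Real.sin θ) L) E : ℝ) / ((L : ℝ) - 1) -
        S / p = ((zeroCount (boundaryPoly V (Real.cos θ) (Real.sin θ) L) E : ℝ) -
          ((L : ℝ) - 1) * (S / p)) / ((L : ℝ) - 1) := by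
      field_simp
    rw [e, abs_div, abs_of_pos hL1]
    refine div_le_div_of_nonneg_right ?_ hL1.le
    rw [abs_le] at b1 b2 b3 b4 b5 ⊢
    constructor <;> linarith [b1.1, b1.2, b2.1, b2.2, b3.1, b3.2, b4.1, b4.2, b5.1, b5.2]
  rw [tendsto_iff_norm_sub_tendsto_zero]
  have hlim : Tendsto (fun L : ℕ => C / ((L : ℝ) - 1)) atTop (𝓝 0) :=
    tendsto_const_nhds.div_atTop
      (tendsto_atTop_add_const_right _ (-1) tendsto_natCast_atTop_atTop)
  refine squeeze_zero' (Eventually.of_forall fun _ => norm_nonneg _) ?_ hlim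
  filter_upwards [eventually_ge_atTop (p + 3)] with L hL
  exact hbound L hL

end IsBands

theorem exists_isIDS (hp : 0 < p) (hV : Function.Periodic V (p : ℤ)) : ∃ k, IsIDS V k := by
  obtain ⟨a, b, h⟩ := exists_isBands hp hV
  have : ∀ E, ∃ l, ∀ θ, Tendsto (fun L : ℕ => finiteIDS V θ L E) atTop (𝓝 l) := fun E => by
    have hκ : ∀ j, ∃ κ, 1 ≤ j → j ≤ p → h.HasDensity hp hV E j κ := fun j => by
      by_cases hj : 1 ≤ j ∧ j ≤ p
      · obtain ⟨κ, hκ⟩ := h.exists_hasDensity hp hV E hj.1 hj.2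
        exact ⟨κ, fun _ _ => hκ⟩
      · exact ⟨0, fun h1 h2 => absurd ⟨h1, h2⟩ hj⟩
    choose κ hκ using hκ
    exact ⟨_, h.tendsto_finiteIDS hp hV hκ⟩
  choose k hk using this
  exact ⟨k, hk⟩

namespace IsBands

variable {a b : ℕ → ℝ}

theorem ids_eq (hp : 0 < p) (hV : Function.Periodic V (p : ℤ))
    (h : IsBands p V (bounded_of_periodic hp hV) a b) {k : ℝ → ℝ} (hk : IsIDS V k) {E : ℝ}
    {κ : ℕ → ℝ} (hκ : ∀ j, 1 ≤ j → j ≤ p → h.HasDensity hp hV E j (κ j)) :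
    k E = (∑ j ∈ Finset.Icc 1 p, κ j) / p :=
  tendsto_nhds_unique (hk E 0) (h.tendsto_finiteIDS hp hV hκ 0)

/-- Non-strict inequalities suffice because nodes never sit on band edges; this covers collapsed
gaps. -/
theorem ids_eq_of_between (hp : 0 < p) (hV : Function.Periodic V (p : ℤ))
    (h : IsBands p V (bounded_of_periodic hp hV) a b) {k : ℝ → ℝ} (hk : IsIDS V k) {E : ℝ}
    {j : ℕ} (hj : j ≤ p) (hl : 1 ≤ j → b j ≤ E) (hr : j < p → E ≤ a (j + 1)) :
    k E = (j : ℝ) / p := by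
  rw [h.ids_eq hp hV hk (κ := fun i => if i ≤ j then 1 else 0)]
  · rw [Finset.sum_boole]
    congr 2
    rw [show (Finset.Icc 1 p).filter (fun i => i ≤ j) = Finset.Icc 1 j by
      ext i; simp only [Finset.mem_filter, Finset.mem_Icc]; omega]
    simp
  · intro i h1 h2
    split_ifs with hij
    · exact h.hasDensity_one hp hV h1 h2 ((h.right_mono h1 hij hj).trans (hl (by omega)))
    · exact h.hasDensity_zero hp hV h1 h2
        ((hr (by omega)).trans (h.left_mono (by omega) (by omega) h2))

theorem ids_eq_of_hasDensity (hp : 0 < p) (hV : Function.Periodic V (p : ℤ))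
    (h : IsBands p V (bounded_of_periodic hp hV) a b) {k : ℝ → ℝ} (hk : IsIDS V k) {E : ℝ}
    {j : ℕ} (h1 : 1 ≤ j) (h2 : j ≤ p) (hE : E ∈ Icc (a j) (b j)) {κ : ℝ}
    (hκ : h.HasDensity hp hV E j κ) : k E = ((j : ℝ) - 1 + κ) / p := by
  rw [h.ids_eq hp hV hk (κ := fun i => (if i < j then 1 else 0) + if i = j then κ else 0)]
  · congr 1
    rw [Finset.sum_add_distrib, Finset.sum_boole, Finset.sum_ite_eq',
      if_pos (Finset.mem_Icc.mpr ⟨h1, h2⟩),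
      show (Finset.Icc 1 p).filter (fun i => i < j) = Finset.Ico 1 j by
        ext i; simp only [Finset.mem_filter, Finset.mem_Icc, Finset.mem_Ico]; omega]
    rw [Nat.card_Ico, Nat.cast_sub h1, Nat.cast_one]
  · intro i hi1 hi2
    rcases lt_trichotomy i j with hij | rfl | hij
    · simpa [hij, hij.ne] using
        h.hasDensity_one hp hV hi1 hi2 ((h.right_le_left hi1 hij h2).trans hE.1)
    · simpa using hκ
    · simpa [hij.not_gt, hij.ne'] using
        h.hasDensity_zero hp hV hi1 hi2 (hE.2.trans (h.right_le_left h1 hij hi2))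

theorem ids_eq_of_mem_gap (hp : 0 < p) (hV : Function.Periodic V (p : ℤ))
    (h : IsBands p V (bounded_of_periodic hp hV) a b) {k : ℝ → ℝ} (hk : IsIDS V k) {E : ℝ}
    {j : ℕ} (hj : j ≤ p) (hE : E ∈ gap p a b j) : k E = (j : ℝ) / p := by
  rw [gap] at hE
  split_ifs at hE with h0 hjp hlt
  · subst h0
    exact h.ids_eq_of_between hp hV hk hj (fun h1 => absurd h1 (by omega)) fun _ => hE.le
  · subst hjp
    exact h.ids_eq_of_between hp hV hk hj (fun _ => hE.le) fun h1 => absurd h1 (lt_irrefl _)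
  · exact h.ids_eq_of_between hp hV hk hj (fun _ => hE.1.le) fun _ => hE.2.le
  · rw [mem_singleton_iff] at hE
    exact h.ids_eq_of_between hp hV hk hj (fun _ => hE.ge) fun hjp' =>
      hE.le.trans (h.le j (by omega) hjp')

theorem existsUnique_angle (hp : 0 < p) (hV : Function.Periodic V (p : ℤ))
    (h : IsBands p V (bounded_of_periodic hp hV) a b) {E : ℝ} {j : ℕ} (h1 : 1 ≤ j) (h2 : j ≤ p)
    (hE : E ∈ Icc (a j) (b j)) :
    ∃! ϑ : ℝ, ϑ ∈ Icc 0 (Real.pi / p) ∧ discriminant p V E = 2 * Real.cos (p * ϑ) := by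
  have hpR : (0 : ℝ) < p := by exact_mod_cast hp
  have hmem : ∀ ϑ ∈ Icc 0 (Real.pi / p), p * ϑ ∈ Icc 0 Real.pi := fun ϑ hϑ =>
    ⟨mul_nonneg hpR.le hϑ.1, by
      rw [mul_comm]; exact (le_div_iff₀ hpR).mp hϑ.2⟩
  obtain ⟨α, hα, hD⟩ := h.exists_angle hp hV h1 h2 hE
  refine ⟨α * Real.pi / p, ⟨⟨?_, ?_⟩, ?_⟩, ?_⟩
  · exact div_nonneg (mul_nonneg hα.1 Real.pi_pos.le) hpR.le
  · exact div_le_div_of_nonneg_right (mul_le_of_le_one_left Real.pi_pos.le hα.2) hpR.le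
  · rw [mul_div_cancel₀ _ hpR.ne', hD]
  · rintro ϑ ⟨hϑ, hϑD⟩
    have hαm : α * Real.pi ∈ Icc 0 Real.pi :=
      ⟨mul_nonneg hα.1 Real.pi_pos.le, mul_le_of_le_one_left Real.pi_pos.le hα.2⟩
    have hcos : Real.cos (p * ϑ) = Real.cos (α * Real.pi) :=
      mul_left_cancel₀ two_ne_zero (hϑD.symm.trans hD)
    rw [eq_div_iff hpR.ne', mul_comm]
    exact Real.injOn_cos (hmem ϑ hϑ) hαm hcos

end IsBands

end Counting

end PeriodicJacobi

end

open PeriodicJacobi in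
theorem theorem1p1 (p : ℕ) (hp : 0 < p) (V : ℤ → ℝ) (hV : Function.Periodic V (p : ℤ)) :
    ∃ k : ℝ → ℝ, IsIDS V k ∧
      (∃ a b : ℕ → ℝ, IsBands p V (bounded_of_periodic hp hV) a b) ∧
      ∀ a b : ℕ → ℝ, IsBands p V (bounded_of_periodic hp hV) a b →
        (∀ j ≤ p, ∀ E ∈ gap p a b j, k E = (j : ℝ) / p) ∧
        (∀ j, 1 ≤ j → j ≤ p → ∀ E ∈ Set.Icc (a j) (b j),
          (∃! ϑ : ℝ, ϑ ∈ Set.Icc 0 (Real.pi / p) ∧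
            discriminant p V E = 2 * Real.cos (p * ϑ)) ∧
          ∀ ϑ ∈ Set.Icc 0 (Real.pi / p), discriminant p V E = 2 * Real.cos (p * ϑ) →
            (Even (p - j) → k E = (j : ℝ) / p - ϑ / Real.pi) ∧
            (Odd (p - j) → k E = ((j : ℝ) - 1) / p + ϑ / Real.pi)) := by
  obtain ⟨k, hk⟩ := exists_isIDS hp hV
  refine ⟨k, hk, exists_isBands hp hV, fun a b h =>
    ⟨fun j hj E hE => h.ids_eq_of_mem_gap hp hV hk hj hE, fun j h1 h2 E hE =>
      ⟨h.existsUnique_angle hp hV h1 h2 hE, fun ϑ hϑ hD => ?_⟩⟩⟩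
  have hpR : (0 : ℝ) < p := by exact_mod_cast hp
  have hπ := Real.pi_pos
  -- The node fraction is `α = p ϑ / π`, so dividing by the number of bands leaves `ϑ / π`.
  have hα : p * ϑ / Real.pi ∈ Set.Icc (0 : ℝ) 1 := by
    refine ⟨div_nonneg (mul_nonneg hpR.le hϑ.1) hπ.le, div_le_one_of_le₀ ?_ hπ.le⟩
    rw [mul_comm]
    exact (le_div_iff₀ hpR).mp hϑ.2
  have hD' : discriminant p V E = 2 * Real.cos (p * ϑ / Real.pi * Real.pi) := by
    rw [hD, div_mul_cancel₀ _ hπ.ne']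
  constructor
  · intro he
    rw [h.ids_eq_of_hasDensity hp hV hk h1 h2 hE
      (h.hasDensity_of_even hp hV h1 h2 hE he hα hD')]
    field_simp
    ring
  · intro ho
    rw [h.ids_eq_of_hasDensity hp hV hk h1 h2 hE
      (h.hasDensity_of_odd hp hV h1 h2 hE ho hα hD')]
    field_simp
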